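/- **Setting.** An instance of the constrained bandit recommendation problem consists of $U \ge 1$ users, $K \ge 1$ arms, a horizon $T \ge \max\{U, K\}$, a budget $B \in \mathbb{N}$, arm costs $0 < c_k \le B$, and, for every user $u$ and arm $k$, a probability distribution $D_{u,k}$ supported on $[0,1]$ with mean $\theta_{u,k}$. No structure is assumed on the matrix $\Theta = (\theta_{u,k})$. A matching is a map $\pi : [U] \to [K]$. It is feasible if $\sum_{k \in \mathrm{Im}(\pi)} c_k \le B$, and its value is $V(\pi;\Theta) = \sum_{u} \theta_{u,\pi(u)}$; $\Pi$ denotes the set of feasible matchings. In each round $t = 1, \dots, T$ the learner, who knows $T, U, K, B, (c_k)_k$ but not the distributions, plays a feasible matching $\pi_t$ that depends on past observations, and then observes the rewards $r^t_{u,\pi_t(u)}$, $u \in [U]$, where the $r^t_{u,k} \sim D_{u,k}$ are independent over all $t, u, k$. For $\alpha \in (0,1]$ its expected cumulative $\alpha$-regret is $$R_\alpha(T) = \alpha \, T \max_{\pi \in \Pi} V(\pi;\Theta) - \mathbb{E}\Big[\sum_{t=1}^T \sum_{u \in [U]} r^t_{u,\pi_t(u)}\Big].$$ Running time is measured by the number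 of steps of a program for a real random access machine: unit-cost memory access, comparison, addition and truncated subtraction of natural numbers, field operations on real numbers, and conversion of a natural number to a real number; there is no rounding of real numbers. The program is run once in each round, its memory persists between rounds, it finds $T, U, K, B, (c_k)_k$ in memory before the first round, and the new observations are written to its memory after each round. **Proposition.** There are a single program and universal constants $C_1, C_2$ such that for every instance as above the program plays a feasible matching in every round, uses at most $C_1 K^3 U$ steps in every round (whatever it observes), and satisfies $$R_{1/2}(T) \le C_2\, U\, (K + \beta)^{4/3}\, T^{2/3} (\log T)^{1/3}, \qquad \beta = \frac{B}{\min_k c_k}.$$ In particular $R_{1/2}(T) = \tilde O\big(U (K+\beta)^{4/3} T^{2/3}\big)$, with per-round time $O(K^3 U)$. -/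

import Mathlib

open MeasureTheory

/-! ### The constrained bandit recommendation problem -/

namespace CBR

/-- The part of an instance that is known to the learner: horizon `T`, number of users `U`, number of
arms `K`, budget `B` and arm costs. Users, arms and rounds are numbered from `0`. -/
structure Params where
  T : ℕ
  U : ℕ
  K : ℕ
  B : ℕ
  cost : Fin K → ℝ
  U_pos : 0 < U
  K_pos : 0 < K
  U_le_T : U ≤ T
  K_le_T : K ≤ T
  cost_pos : ∀ k, 0 < cost k
  cost_le : ∀ k, cost k ≤ B

/-- A matching assigns one arm to each user. -/
abbrev Matching (P : Params) : Type := Fin P.U → Fin P.K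

/-- A matching is feasible if the total cost of the arms in its image is within the budget. -/
def Feasible (P : Params) (π : Matching P) : Prop :=
  ∑ k ∈ Finset.univ.image π, P.cost k ≤ P.B

/-- The ratio of the budget to the minimal cost (the infimum is over a finite nonempty set). -/
noncomputable def beta (P : Params) : ℝ := P.B / ⨅ k, P.cost k

/-- The part of an instance that is unknown to the learner: a reward distribution, supported on
`[0, 1]`, for each user and arm. -/
structure Env (P : Params) where
  D : Fin P.U → Fin P.K → Measure ℝ
  prob : ∀ u k, IsProbabilityMeasure (D u k)
  supp : ∀ u k, ∀ᵐ x ∂(D u k), x ∈ Set.Icc (0 : ℝ) 1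

/-- The expected reward matrix. -/
noncomputable def Env.theta {P : Params} (E : Env P) (u : Fin P.U) (k : Fin P.K) : ℝ :=
  ∫ x, x ∂(E.D u k)

/-- The expected value of a matching. -/
noncomputable def Env.value {P : Params} (E : Env P) (π : Matching P) : ℝ :=
  ∑ u, E.theta u (π u)

/-- The largest value of a feasible matching. -/
noncomputable def Env.opt {P : Params} (E : Env P) : ℝ :=
  sSup (E.value '' {π | Feasible P π})

/-- The supremum in `Env.opt` is a maximum. -/
theorem Env.isGreatest_opt {P : Params} (E : Env P) :
    IsGreatest (E.value '' {π | Feasible P π}) E.opt := by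
  have hfin : (E.value '' {π | Feasible P π}).Finite := (Set.toFinite _).image _
  suffices hne : (E.value '' {π | Feasible P π}).Nonempty from
    ⟨hne.csSup_mem hfin, fun _ hv => le_csSup hfin.bddAbove hv⟩
  refine ⟨_, fun _ => ⟨0, P.K_pos⟩, ?_, rfl⟩
  have : Nonempty (Fin P.U) := ⟨⟨0, P.U_pos⟩⟩
  simp only [Set.mem_ofPred_eq, Feasible]
  rw [Finset.image_const Finset.univ_nonempty, Finset.sum_singleton]
  exact P.cost_le _

/-- A table of potential rewards: the entry `(t, u, k)` is the reward that is generated in round `t`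
if user `u` is matched to arm `k` in that round. -/
abbrev Table (P : Params) : Type := ℕ × Fin P.U × Fin P.K → ℝ

/-- The law of the table: independent entries, the entry `(t, u, k)` having law `D u k`. -/
noncomputable def Env.law {P : Params} (E : Env P) : Measure (Table P) :=
  haveI : ∀ i : ℕ × Fin P.U × Fin P.K, IsProbabilityMeasure (E.D i.2.1 i.2.2) :=
    fun i => E.prob i.2.1 i.2.2
  Measure.infinitePi fun i : ℕ × Fin P.U × Fin P.K => E.D i.2.1 i.2.2

/-- What is observed in a round (semi-bandit feedback): the reward of each user from its own arm. -/
abbrev Obs (P : Params) : Type := Fin P.U → ℝ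

/-- A deterministic learner: the matching of the next round as a function of the observations of the
past rounds, latest first. (The past matchings are determined by the past observations.) -/
abbrev Learner (P : Params) : Type := List (Obs P) → Matching P

/-- The observations of the rounds before round `t`, latest first, when learner `A` plays against
the table `r`. -/
def Learner.history {P : Params} (A : Learner P) (r : Table P) : ℕ → List (Obs P)
  | 0 => []
  | t + 1 => (fun u => r (t, u, A (Learner.history A r t) u)) :: Learner.history A r t

/-- The matching that is played in round `t`. -/
def Learner.play {P : Params} (A : Learner P) (r : Table P) (t : ℕ) : Matching P :=
  A (Learner.history A r t)

/-- The total realized reward of rounds `0, …, T - 1`. -/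
noncomputable def Learner.reward {P : Params} (A : Learner P) (r : Table P) : ℝ :=
  ∑ t ∈ Finset.range P.T, ∑ u, r (t, u, Learner.play A r t u)

/-- The expected cumulative `α`-regret over `T` rounds. -/
noncomputable def alphaRegret {P : Params} (α : ℝ) (E : Env P) (A : Learner P) : ℝ :=
  α * P.T * E.opt - ∫ r, Learner.reward A r ∂E.law

end CBR

/-! ### The real random access machine

The memory consists of arrays of natural numbers and arrays of real numbers. An elementary step is a
memory access, an addition or (truncated) subtraction of naturals, a field operation on reals, the
conversion of a natural number to a real number, a comparison, a Boolean connective, or the transfer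
of control. There is no rounding, and no unit-cost multiplication of naturals. -/

namespace RealRAM

/-- The memory: cell `i` of the array `a` of naturals, and of the array `a` of reals. -/
structure Mem where
  nat : ℕ → ℕ → ℕ
  real : ℕ → ℕ → ℝ

/-- Overwrite cell `i` of the array `a` of naturals. -/
def Mem.setNat (m : Mem) (a i v : ℕ) : Mem :=
  { m with nat := Function.update m.nat a (Function.update (m.nat a) i v) }

/-- Overwrite cell `i` of the array `a` of reals. -/
noncomputable def Mem.setReal (m : Mem) (a i : ℕ) (v : ℝ) : Mem :=
  { m with real := Function.update m.real a (Function.update (m.real a) i v) }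

/-- Natural number expressions. `get a e` is the cell of the array `a` whose index is the value
of `e`. -/
inductive NExp where
  | lit (n : ℕ)
  | get (a : ℕ) (e : NExp)
  | add (e₁ e₂ : NExp)
  | sub (e₁ e₂ : NExp)

/-- Real expressions. -/
inductive RExp where
  | ofNat (e : NExp)
  | get (a : ℕ) (e : NExp)
  | add (e₁ e₂ : RExp)
  | sub (e₁ e₂ : RExp)
  | mul (e₁ e₂ : RExp)
  | div (e₁ e₂ : RExp)

/-- Tests. -/
inductive Test where
  | natLe (e₁ e₂ : NExp)
  | realLe (e₁ e₂ : RExp)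
  | neg (b : Test)
  | conj (b₁ b₂ : Test)

def NExp.eval (m : Mem) : NExp → ℕ
  | lit n => n
  | get a e => m.nat a (e.eval m)
  | add e₁ e₂ => e₁.eval m + e₂.eval m
  | sub e₁ e₂ => e₁.eval m - e₂.eval m

noncomputable def RExp.eval (m : Mem) : RExp → ℝ
  | ofNat e => (e.eval m : ℝ)
  | get a e => m.real a (e.eval m)
  | add e₁ e₂ => e₁.eval m + e₂.eval m
  | sub e₁ e₂ => e₁.eval m - e₂.eval m
  | mul e₁ e₂ => e₁.eval m * e₂.eval m
  | div e₁ e₂ => e₁.eval m / e₂.eval m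

def Test.holds (m : Mem) : Test → Prop
  | natLe e₁ e₂ => e₁.eval m ≤ e₂.eval m
  | realLe e₁ e₂ => e₁.eval m ≤ e₂.eval m
  | neg b => ¬ b.holds m
  | conj b₁ b₂ => b₁.holds m ∧ b₂.holds m

/-- The number of steps of an evaluation: one for each node of the expression. -/
def NExp.steps : NExp → ℕ
  | lit _ => 1
  | get _ e => e.steps + 1
  | add e₁ e₂ => e₁.steps + e₂.steps + 1
  | sub e₁ e₂ => e₁.steps + e₂.steps + 1

def RExp.steps : RExp → ℕ
  | ofNat e => e.steps + 1
  | get _ e => e.steps + 1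
  | add e₁ e₂ => e₁.steps + e₂.steps + 1
  | sub e₁ e₂ => e₁.steps + e₂.steps + 1
  | mul e₁ e₂ => e₁.steps + e₂.steps + 1
  | div e₁ e₂ => e₁.steps + e₂.steps + 1

def Test.steps : Test → ℕ
  | natLe e₁ e₂ => e₁.steps + e₂.steps + 1
  | realLe e₁ e₂ => e₁.steps + e₂.steps + 1
  | neg b => b.steps + 1
  | conj b₁ b₂ => b₁.steps + b₂.steps + 1

/-- Programs. `setNat a i e` and `setReal a i e` store the value of `e` in cell `i` of the array
`a`; `loop b c` repeats `c` as long as `b` holds. -/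
inductive Prog where
  | skip
  | setNat (a : ℕ) (i e : NExp)
  | setReal (a : ℕ) (i : NExp) (e : RExp)
  | seq (c₁ c₂ : Prog)
  | cond (b : Test) (c₁ c₂ : Prog)
  | loop (b : Test) (c : Prog)

/-- `Exec c m n m'`: started in memory `m`, the program `c` halts after `n` steps in memory `m'`. -/
inductive Exec : Prog → Mem → ℕ → Mem → Prop where
  | skip (m : Mem) : Exec .skip m 1 m
  | setNat (a : ℕ) (i e : NExp) (m : Mem) :
      Exec (.setNat a i e) m (i.steps + e.steps + 1) (m.setNat a (i.eval m) (e.eval m))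
  | setReal (a : ℕ) (i : NExp) (e : RExp) (m : Mem) :
      Exec (.setReal a i e) m (i.steps + e.steps + 1) (m.setReal a (i.eval m) (e.eval m))
  | seq {c₁ c₂ : Prog} {m m' m'' : Mem} {n₁ n₂ : ℕ} :
      Exec c₁ m n₁ m' → Exec c₂ m' n₂ m'' → Exec (.seq c₁ c₂) m (n₁ + n₂ + 1) m''
  | condTrue {b : Test} {c₁ c₂ : Prog} {m m' : Mem} {n : ℕ} :
      b.holds m → Exec c₁ m n m' → Exec (.cond b c₁ c₂) m (b.steps + n + 1) m'
  | condFalse {b : Test} {c₁ c₂ : Prog} {m m' : Mem} {n : ℕ} :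
      ¬ b.holds m → Exec c₂ m n m' → Exec (.cond b c₁ c₂) m (b.steps + n + 1) m'
  | loopStop {b : Test} {c : Prog} {m : Mem} :
      ¬ b.holds m → Exec (.loop b c) m (b.steps + 1) m
  | loopStep {b : Test} {c : Prog} {m m' m'' : Mem} {n₁ n₂ : ℕ} :
      b.holds m → Exec c m n₁ m' → Exec (.loop b c) m' n₂ m'' →
        Exec (.loop b c) m (b.steps + n₁ + n₂ + 1) m''

/-- Programs are deterministic. -/
theorem Exec.unique {c : Prog} {m m₁ m₂ : Mem} {n₁ n₂ : ℕ}
    (h₁ : Exec c m n₁ m₁) (h₂ : Exec c m n₂ m₂) : n₁ = n₂ ∧ m₁ = m₂ := by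
  induction h₁ generalizing n₂ m₂ with
  | skip m => cases h₂; exact ⟨rfl, rfl⟩
  | setNat a i e m => cases h₂; exact ⟨rfl, rfl⟩
  | setReal a i e m => cases h₂; exact ⟨rfl, rfl⟩
  | seq _ _ ih₁ ih₂ =>
    cases h₂ with
    | seq g₁ g₂ =>
      obtain ⟨rfl, rfl⟩ := ih₁ g₁
      obtain ⟨rfl, rfl⟩ := ih₂ g₂
      exact ⟨rfl, rfl⟩
  | condTrue hb _ ih =>
    cases h₂ with
    | condTrue _ g => obtain ⟨rfl, rfl⟩ := ih g; exact ⟨rfl, rfl⟩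
    | condFalse hb' _ => exact absurd hb hb'
  | condFalse hb _ ih =>
    cases h₂ with
    | condTrue hb' _ => exact absurd hb' hb
    | condFalse _ g => obtain ⟨rfl, rfl⟩ := ih g; exact ⟨rfl, rfl⟩
  | loopStop hb =>
    cases h₂ with
    | loopStop _ => exact ⟨rfl, rfl⟩
    | loopStep hb' _ _ => exact absurd hb' hb
  | loopStep hb _ _ ih₁ ih₂ =>
    cases h₂ with
    | loopStop hb' => exact absurd hb hb'
    | loopStep _ g₁ g₂ =>
      obtain ⟨rfl, rfl⟩ := ih₁ g₁
      obtain ⟨rfl, rfl⟩ := ih₂ g₂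
      exact ⟨rfl, rfl⟩

open CBR

/-- The memory before the first round: the array `0` of naturals holds `T, U, K, B`, the array `0`
of reals holds the costs, and all other cells are `0`. -/
noncomputable def initMem (P : Params) : Mem where
  nat a i :=
    if a = 0 then
      (if i = 0 then P.T else if i = 1 then P.U else if i = 2 then P.K else if i = 3 then P.B else 0)
    else 0
  real a i := if a = 0 then (if h : i < P.K then P.cost ⟨i, h⟩ else 0) else 0

/-- At the end of a round the observed rewards are written to the cells `0, …, U - 1` of the array
`1` of reals. -/
noncomputable def observe {P : Params} (m : Mem) (x : Obs P) : Mem :=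
  { m with
    real := Function.update m.real 1 fun i => if h : i < P.U then x ⟨i, h⟩ else m.real 1 i }

/-- `AtRound c P h m`: if the program `c` is executed once in each round, then `m` is the memory at
the beginning of the round that follows the observations `h` (latest first). The memory persists
from round to round. -/
inductive AtRound (c : Prog) (P : Params) : List (Obs P) → Mem → Prop where
  | start : AtRound c P [] (initMem P)
  | next {h : List (Obs P)} {m m' : Mem} {n : ℕ} (x : Obs P) :
      AtRound c P h m → Exec c m n m' → AtRound c P (x :: h) (observe m' x)

/-- The program `c`, executed once in each of the `T` rounds, implements the learner `A` with at most
`τ` steps in every round, whatever is observed: it halts within `τ` steps, and it leaves the matching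
of the round in the cells `0, …, U - 1` of the array `1` of naturals. -/
def Implements (c : Prog) {P : Params} (A : Learner P) (τ : ℕ) : Prop :=
  ∀ (h : List (Obs P)) (m : Mem), h.length < P.T → AtRound c P h m →
    ∃ (n : ℕ) (m' : Mem), Exec c m n m' ∧ n ≤ τ ∧ ∀ u : Fin P.U, m'.nat 1 u = (A h u : ℕ)

end RealRAM

/-!
Explore each arm for `N = ⌈T ^ (2 / 3)⌉` rounds, then play in every round the matching that a greedy
algorithm computes from the rewards summed over the exploration.

The value of the best assignment of a set of arms to the users is a monotone submodular function of
the set. Starting from the empty set, the algorithm adds the affordable arm with the largest gain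
per cost, and it also records the best assignment that is obtained by adding one affordable arm.
Let `o` be the most expensive arm of an optimal matching. As long as `o` is affordable, `o` together
with the selected arms is a candidate, and the other optimal arms cost at most `B - cost o`; so
either a candidate has half the optimal value, or the next arm has a gain per cost of more than half
the optimal value divided by `B - cost o`. The latter cannot go on: the selected arms would be worth
half the optimal value once they cost `B - cost o`.

The sum of `N` independent rewards has standard deviation at most `√N`, so the expected sum of the
estimation errors over users and arms is at most `U K √N`. This gives a regret of order `U K T / √N`
after the exploration, besides the `U K N` of the exploration itself.

Each of the `K` greedy steps computes at most `K` gains in `O(U)` time. Expected rewards make sense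
since the learner is measurable, which holds because a program with bounded running time computes it
from the observations.
-/

/-- Assigning arms to the users in `ι` under a budget for the total cost of the assigned arms: the
arms are the numbers below `K`, and user `u` contributes `weight u k` if its arm is `k`. -/
structure BudgetedAssignment (ι : Type*) where
  K : ℕ
  weight : ι → ℕ → ℝ
  cost : ℕ → ℝ
  budget : ℝ
  K_pos : 0 < K
  weight_nonneg : ∀ u k, 0 ≤ weight u k
  cost_pos : ∀ k < K, 0 < cost k
  cost_le : ∀ k < K, cost k ≤ budget

namespace BudgetedAssignment

open Finset

/-- A set of arms under construction, represented by the best weight `level u` that it offers to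
user `u` and an arm `arm u` that offers it (arbitrary if the level is `0`), its cost and its
value. -/
@[ext]
structure Selection (ι : Type*) where
  level : ι → ℝ
  arm : ι → ℕ
  cost : ℝ
  value : ℝ

/-- The best assignment found so far, with a lower bound for its value. -/
@[ext]
structure Candidate (ι : Type*) where
  assignment : ι → ℕ
  bound : ℝ

/-- The arm of largest gain per cost found so far; the density `0` stands for no arm. -/
@[ext]
structure Choice where
  arm : ℕ
  density : ℝ

section Algorithm

variable {ι : Type*} [Fintype ι] (p : BudgetedAssignment ι)

/-- An assignment is feasible if its arms exist and their total cost is within the budget. -/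
structure IsFeasible (π : ι → ℕ) : Prop where
  lt : ∀ u, π u < p.K
  cost_le : ∑ k ∈ univ.image π, p.cost k ≤ p.budget

/-- The total weight of an assignment. -/
def value (π : ι → ℕ) : ℝ := ∑ u, p.weight u (π u)

/-- The increase of the value of a selection if arm `k` is added. -/
def gain (s : Selection ι) (k : ℕ) : ℝ := ∑ u, max 0 (p.weight u k - s.level u)

/-- The assignment in which every user to whom arm `k` offers at least its level moves to `k`. -/
noncomputable def switch (s : Selection ι) (k : ℕ) : ι → ℕ :=
  fun u => if s.level u ≤ p.weight u k then k else s.arm u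

/-- The selection with arm `k` added. -/
@[simps]
noncomputable def add (s : Selection ι) (k : ℕ) : Selection ι where
  level u := max (s.level u) (p.weight u k)
  arm := p.switch s k
  cost := s.cost + p.cost k
  value := s.value + p.gain s k

/-- Compare the candidate `x` with the assignment obtained from `s` by adding arm `k`. -/
noncomputable def improve (s : Selection ι) (k : ℕ) (x : Candidate ι) : Candidate ι :=
  if x.bound < s.value + p.gain s k then ⟨p.switch s k, s.value + p.gain s k⟩ else x

/-- Compare the density of arm `k` with that of the choice `d`. -/
noncomputable def prefer (s : Selection ι) (k : ℕ) (d : Choice) : Choice :=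
  if d.density < p.gain s k / p.cost k then ⟨k, p.gain s k / p.cost k⟩ else d

/-- The comparisons for the first arms that still fit into the budget of the selection `s`. -/
noncomputable def scan (s : Selection ι) (x : Candidate ι) : ℕ → Candidate ι × Choice
  | 0 => (x, ⟨0, 0⟩)
  | i + 1 =>
    if p.cost i + s.cost ≤ p.budget then
      (p.improve s i (scan s x i).1, p.prefer s i (scan s x i).2)
    else scan s x i

/-- Add the chosen arm, if there is one. -/
noncomputable def extendBy (s : Selection ι) (d : Choice) : Selection ι :=
  if 0 < d.density then p.add s d.arm else s

/-- The selection and the candidate after some steps of the greedy algorithm. -/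
noncomputable def state : ℕ → Selection ι × Candidate ι
  | 0 => (⟨0, 0, 0, 0⟩, ⟨0, 0⟩)
  | j + 1 =>
    let r := p.scan (state j).1 (state j).2 p.K
    (p.extendBy (state j).1 r.2, r.1)

/-- The outcome of the greedy algorithm. -/
noncomputable def greedy : ι → ℕ := (p.state p.K).2.assignment

/-- The choice made by the greedy algorithm in step `j`. -/
noncomputable def choice (j : ℕ) : Choice := (p.scan (p.state j).1 (p.state j).2 p.K).2

/-- The set of arms that have been added in the first `j` steps of the greedy algorithm. -/
noncomputable def picked : ℕ → Finset ℕ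
  | 0 => ∅
  | j + 1 => if 0 < (p.choice j).density then insert (p.choice j).arm (picked j) else picked j

/-- The selection `s` represents the set `G` of arms. -/
structure Represents (s : Selection ι) (G : Finset ℕ) : Prop where
  level_nonneg : ∀ u, 0 ≤ s.level u
  value_eq : s.value = ∑ u, s.level u
  subset : G ⊆ range p.K
  sum_cost_le : ∑ k ∈ G, p.cost k ≤ s.cost
  cost_le : s.cost ≤ p.budget
  weight_le : ∀ k ∈ G, ∀ u, p.weight u k ≤ s.level u
  attained : ∀ u, s.level u = 0 ∨ s.arm u ∈ G ∧ s.level u = p.weight u (s.arm u)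

/-- The candidate is feasible and its value is at least the recorded bound. -/
structure IsSound (x : Candidate ι) : Prop where
  feasible : p.IsFeasible x.assignment
  bound_le : x.bound ≤ p.value x.assignment

end Algorithm

variable {ι : Type*} {p : BudgetedAssignment ι} {s : Selection ι} {x : Candidate ι}
  {G : Finset ℕ} {π : ι → ℕ} {i j k o : ℕ}

theorem level_add_gain (s : Selection ι) (u : ι) :
    s.level u + max 0 (p.weight u k - s.level u) = max (s.level u) (p.weight u k) := by
  rw [← max_add_add_left, add_zero, add_sub_cancel]

theorem sum_insert_cost_le (hk : k < p.K) :
    ∑ i ∈ insert k G, p.cost i ≤ p.cost k + ∑ i ∈ G, p.cost i := by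
  by_cases hkG : k ∈ G
  · rw [insert_eq_of_mem hkG]
    linarith [p.cost_pos k hk]
  · rw [sum_insert hkG]

variable [Fintype ι]

theorem value_nonneg (p : BudgetedAssignment ι) (π : ι → ℕ) : 0 ≤ p.value π :=
  sum_nonneg fun _ _ => p.weight_nonneg _ _

theorem IsFeasible.lt_of_mem_image (hπ : p.IsFeasible π) (hk : k ∈ univ.image π) : k < p.K := by
  obtain ⟨u, -, rfl⟩ := mem_image.1 hk
  exact hπ.lt u

theorem isFeasible_of_image_subset (hG : G ⊆ range p.K) (hcost : ∑ k ∈ G, p.cost k ≤ p.budget)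
    (hπ : ∀ u, π u ∈ G) : p.IsFeasible π where
  lt u := mem_range.1 (hG (hπ u))
  cost_le := hcost.trans' <| sum_le_sum_of_subset_of_nonneg (image_subset_iff.2 fun u _ => hπ u)
    fun k hk _ => (p.cost_pos k (mem_range.1 (hG hk))).le

/-- Every user's weight is at most its level plus the gain that its own arm offers to it. -/
theorem value_le_sum_level_add_sum_gain (s : Selection ι) (π : ι → ℕ) :
    p.value π ≤ ∑ u, s.level u + ∑ k ∈ univ.image π, p.gain s k := by
  unfold gain value
  rw [sum_comm, ← sum_add_distrib]
  refine sum_le_sum fun u _ => ?_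
  have own_le : max 0 (p.weight u (π u) - s.level u) ≤
      ∑ k ∈ univ.image π, max 0 (p.weight u k - s.level u) :=
    single_le_sum (f := fun k => max 0 (p.weight u k - s.level u)) (fun _ _ => le_max_left _ _)
      (mem_image_of_mem π (mem_univ u))
  linarith [le_max_right 0 (p.weight u (π u) - s.level u)]

namespace Represents

theorem value_nonneg (h : p.Represents s G) : 0 ≤ s.value :=
  h.value_eq ▸ sum_nonneg fun u _ => h.level_nonneg u

theorem gain_eq_zero (h : p.Represents s G) (hk : k ∈ G) : p.gain s k = 0 :=
  sum_eq_zero fun u _ => max_eq_left (sub_nonpos.2 (h.weight_le k hk u))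

theorem switch_mem_insert (h : p.Represents s G) (k : ℕ) (u : ι) :
    p.switch s k u ∈ insert k G ∧ p.weight u (p.switch s k u) = max (s.level u) (p.weight u k) := by
  unfold switch
  split_ifs with hle
  · exact ⟨mem_insert_self _ _, (max_eq_right hle).symm⟩
  · rw [max_eq_left (not_le.1 hle).le]
    rcases h.attained u with h0 | ⟨hG, heq⟩
    · exact absurd (h0 ▸ p.weight_nonneg u k) hle
    · exact ⟨mem_insert_of_mem hG, heq.symm⟩

theorem insert_subset_range (h : p.Represents s G) (hk : k < p.K) : insert k G ⊆ range p.K :=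
  insert_subset (mem_range.2 hk) h.subset

theorem value_switch (h : p.Represents s G) (k : ℕ) :
    p.value (p.switch s k) = s.value + p.gain s k := by
  rw [h.value_eq, gain, ← sum_add_distrib]
  exact sum_congr rfl fun u _ => (h.switch_mem_insert k u).2.trans (level_add_gain s u).symm

theorem isFeasible_switch (h : p.Represents s G) (hk : k < p.K)
    (hfit : p.cost k + s.cost ≤ p.budget) : p.IsFeasible (p.switch s k) :=
  isFeasible_of_image_subset (h.insert_subset_range hk)
    (by linarith [sum_insert_cost_le (G := G) hk, h.sum_cost_le])
    fun u => (h.switch_mem_insert k u).1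

theorem add (h : p.Represents s G) (hk : k < p.K) (hfit : p.cost k + s.cost ≤ p.budget) :
    p.Represents (p.add s k) (insert k G) where
  level_nonneg u := le_max_of_le_left (h.level_nonneg u)
  value_eq := by
    simp only [add_value, add_level, h.value_eq, gain, ← sum_add_distrib, level_add_gain]
  subset := h.insert_subset_range hk
  sum_cost_le := by
    rw [add_cost]
    linarith [sum_insert_cost_le (G := G) hk, h.sum_cost_le]
  cost_le := by rwa [add_cost, add_comm]
  weight_le i hi u := by
    rcases mem_insert.1 hi with rfl | hi
    exacts [le_max_right _ _, le_max_of_le_left (h.weight_le i hi u)]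
  attained u := .inr ⟨(h.switch_mem_insert k u).1, (h.switch_mem_insert k u).2.symm⟩

end Represents

section Scan

theorem bound_le_improve (s : Selection ι) (k : ℕ) (x : Candidate ι) :
    x.bound ≤ (p.improve s k x).bound ∧ s.value + p.gain s k ≤ (p.improve s k x).bound := by
  unfold improve
  split_ifs with h
  exacts [⟨h.le, le_rfl⟩, ⟨le_rfl, not_lt.1 h⟩]

theorem density_le_prefer (s : Selection ι) (k : ℕ) (d : Choice) :
    d.density ≤ (p.prefer s k d).density ∧
      p.gain s k / p.cost k ≤ (p.prefer s k d).density := by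
  unfold prefer
  split_ifs with h
  exacts [⟨h.le, le_rfl⟩, ⟨le_rfl, not_lt.1 h⟩]

theorem IsSound.improve (hx : p.IsSound x) (h : p.Represents s G) (hk : k < p.K)
    (hfit : p.cost k + s.cost ≤ p.budget) : p.IsSound (p.improve s k x) := by
  unfold BudgetedAssignment.improve
  split_ifs
  exacts [⟨h.isFeasible_switch hk hfit, (h.value_switch k).ge⟩, hx]

theorem IsSound.scan (hx : p.IsSound x) (h : p.Represents s G) (hi : i ≤ p.K) :
    p.IsSound (p.scan s x i).1 := by
  induction i with
  | zero => exact hx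
  | succ i ih =>
    rw [BudgetedAssignment.scan]
    split_ifs with hfit
    exacts [(ih (Nat.le_of_succ_le hi)).improve h hi hfit, ih (Nat.le_of_succ_le hi)]

theorem scan_mono (s : Selection ι) (x : Candidate ι) (i : ℕ) :
    (p.scan s x i).1.bound ≤ (p.scan s x (i + 1)).1.bound ∧
      (p.scan s x i).2.density ≤ (p.scan s x (i + 1)).2.density := by
  rw [scan]
  split_ifs
  exacts [⟨(bound_le_improve s i _).1, (density_le_prefer s i _).1⟩, ⟨le_rfl, le_rfl⟩]

theorem bound_le_scan (s : Selection ι) (x : Candidate ι) (i : ℕ) :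
    x.bound ≤ (p.scan s x i).1.bound :=
  monotone_nat_of_le_succ (f := fun i => (p.scan s x i).1.bound) (fun i => (scan_mono s x i).1)
    i.zero_le

theorem scan_density_nonneg (s : Selection ι) (x : Candidate ι) (i : ℕ) :
    0 ≤ (p.scan s x i).2.density :=
  monotone_nat_of_le_succ (f := fun i => (p.scan s x i).2.density) (fun i => (scan_mono s x i).2)
    i.zero_le

theorem le_scan_of_fits (x : Candidate ι) (hk : k < i) (hfit : p.cost k + s.cost ≤ p.budget) :
    s.value + p.gain s k ≤ (p.scan s x i).1.bound ∧
      p.gain s k / p.cost k ≤ (p.scan s x i).2.density := by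
  induction i, hk using Nat.le_induction with
  | base =>
    rw [scan, if_pos hfit]
    exact ⟨(bound_le_improve s k _).2, (density_le_prefer s k _).2⟩
  | succ i _ ih => exact ⟨ih.1.trans (scan_mono s x i).1, ih.2.trans (scan_mono s x i).2⟩

theorem scan_choice_spec (hd : 0 < (p.scan s x i).2.density) :
    (p.scan s x i).2.arm < i ∧ p.cost (p.scan s x i).2.arm + s.cost ≤ p.budget ∧
      (p.scan s x i).2.density =
        p.gain s (p.scan s x i).2.arm / p.cost (p.scan s x i).2.arm := by
  induction i with
  | zero => exact absurd hd (lt_irrefl 0)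
  | succ i ih =>
    rw [scan] at hd ⊢
    split_ifs at hd ⊢ with hfit
    · unfold prefer at hd ⊢
      split_ifs at hd ⊢
      exacts [⟨i.lt_succ_self, hfit, rfl⟩, (ih hd).imp_left Nat.lt_succ_of_lt]
    · exact (ih hd).imp_left Nat.lt_succ_of_lt

/-- Apart from the most expensive arm `o`, the arms of `π` cost at most `budget - cost o`, so their
gains add up to at most `density * (budget - cost o)`; the gain of `o` itself is accounted for by
the candidate. -/
theorem value_le_bound_add_density_mul (h : p.Represents s G) (x : Candidate ι)
    (hπ : p.IsFeasible π) (ho : o ∈ univ.image π) (hmax : ∀ k ∈ univ.image π, p.cost k ≤ p.cost o)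
    (hcost : s.cost ≤ p.budget - p.cost o) :
    p.value π ≤ (p.scan s x p.K).1.bound +
      (p.scan s x p.K).2.density * (p.budget - p.cost o) := by
  set d := (p.scan s x p.K).2.density
  have le_scan : ∀ k ∈ univ.image π, s.value + p.gain s k ≤ (p.scan s x p.K).1.bound ∧
      p.gain s k / p.cost k ≤ d := fun k hk =>
    le_scan_of_fits x (hπ.lt_of_mem_image hk) (by linarith [hmax k hk])
  have others_gain : ∑ k ∈ (univ.image π).erase o, p.gain s k ≤
      d * ∑ k ∈ (univ.image π).erase o, p.cost k := by
    rw [mul_sum]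
    refine sum_le_sum fun k hk => ?_
    have hk := mem_of_mem_erase hk
    exact (div_le_iff₀ (p.cost_pos k (hπ.lt_of_mem_image hk))).1 (le_scan k hk).2
  have others_cost : ∑ k ∈ (univ.image π).erase o, p.cost k ≤ p.budget - p.cost o := by
    linarith [hπ.cost_le, add_sum_erase _ p.cost ho]
  have value_le := value_le_sum_level_add_sum_gain (p := p) s π
  rw [← h.value_eq, ← add_sum_erase _ _ ho] at value_le
  linarith [(le_scan o ho).1,
    mul_le_mul_of_nonneg_left others_cost (scan_density_nonneg (p := p) s x p.K)]

end Scan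

section Greedy

theorem state_succ_fst (p : BudgetedAssignment ι) (j : ℕ) :
    (p.state (j + 1)).1 = p.extendBy (p.state j).1 (p.choice j) := rfl

theorem state_succ_snd (p : BudgetedAssignment ι) (j : ℕ) :
    (p.state (j + 1)).2 = (p.scan (p.state j).1 (p.state j).2 p.K).1 := rfl

theorem choice_spec (hd : 0 < (p.choice j).density) :
    (p.choice j).arm < p.K ∧ p.cost (p.choice j).arm + (p.state j).1.cost ≤ p.budget ∧
      p.gain (p.state j).1 (p.choice j).arm = (p.choice j).density * p.cost (p.choice j).arm := by
  obtain ⟨hlt, hfit, heq⟩ := scan_choice_spec hd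
  exact ⟨hlt, hfit, ((eq_div_iff (p.cost_pos _ hlt).ne').1 heq).symm⟩

theorem bound_state_le_succ (p : BudgetedAssignment ι) (j : ℕ) :
    (p.state j).2.bound ≤ (p.state (j + 1)).2.bound :=
  bound_le_scan _ _ _

theorem represents_picked (p : BudgetedAssignment ι) (j : ℕ) :
    p.Represents (p.state j).1 (p.picked j) := by
  induction j with
  | zero =>
    exact
      { level_nonneg := fun _ => le_rfl
        value_eq := sum_const_zero.symm
        subset := empty_subset _
        sum_cost_le := sum_empty.le
        cost_le := (p.cost_pos 0 p.K_pos).le.trans (p.cost_le 0 p.K_pos)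
        weight_le := fun _ hk => absurd hk (notMem_empty _)
        attained := fun _ => .inl rfl }
  | succ j ih =>
    rw [state_succ_fst, extendBy, picked]
    split_ifs with hd
    · exact ih.add (choice_spec hd).1 (choice_spec hd).2.1
    · exact ih

theorem isSound_state (p : BudgetedAssignment ι) (j : ℕ) : p.IsSound (p.state j).2 := by
  induction j with
  | zero =>
    refine ⟨isFeasible_of_image_subset (G := {0}) ?_ ?_ fun _ => mem_singleton_self 0,
      p.value_nonneg _⟩
    · exact singleton_subset_iff.2 (mem_range.2 p.K_pos)
    · rw [sum_singleton]
      exact p.cost_le 0 p.K_pos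
  | succ j ih => exact ih.scan (p.represents_picked j) le_rfl

theorem greedy_isFeasible (p : BudgetedAssignment ι) : p.IsFeasible p.greedy :=
  (p.isSound_state p.K).feasible

theorem value_state_le_bound (p : BudgetedAssignment ι) (j : ℕ) :
    (p.state j).1.value ≤ (p.state j).2.bound := by
  induction j with
  | zero => exact le_rfl
  | succ j ih =>
    rw [state_succ_fst, state_succ_snd, extendBy]
    split_ifs with hd
    · exact (le_scan_of_fits _ (choice_spec hd).1 (choice_spec hd).2.1).1
    · exact ih.trans (p.bound_state_le_succ j)

theorem choice_arm_notMem_picked (hd : 0 < (p.choice j).density) :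
    (p.choice j).arm ∉ p.picked j := fun hmem => by
  obtain ⟨hlt, -, gain_eq⟩ := choice_spec hd
  rw [(p.represents_picked j).gain_eq_zero hmem] at gain_eq
  exact (mul_pos hd (p.cost_pos _ hlt)).ne gain_eq

/-- While the candidate has less than half the value of `π`, every step adds a new arm, and the
ratio of value to cost of the selection is at least half the ratio of the value of `π` to the cost
that is left to `π` besides its most expensive arm `o`. Hence `o` keeps fitting in. -/
theorem progress_of_two_mul_bound_lt (hπ : p.IsFeasible π) (ho : o ∈ univ.image π)
    (hmax : ∀ k ∈ univ.image π, p.cost k ≤ p.cost o)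
    (hlt : 2 * (p.state j).2.bound < p.value π) :
    #(p.picked j) = j ∧ (p.state j).1.cost ≤ p.budget - p.cost o ∧
      p.value π * (p.state j).1.cost ≤ 2 * (p.state j).1.value * (p.budget - p.cost o) := by
  have room_nonneg : 0 ≤ p.budget - p.cost o :=
    sub_nonneg.2 (p.cost_le o (hπ.lt_of_mem_image ho))
  induction j with
  | zero => exact ⟨rfl, room_nonneg, by simp [state]⟩
  | succ j ih =>
    obtain ⟨card_eq, cost_le, ratio_le⟩ := ih (by linarith [p.bound_state_le_succ j])
    have value_le_bound := p.value_state_le_bound (j + 1)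
    have value_pos : 0 < p.value π := by
      linarith [(p.represents_picked (j + 1)).value_nonneg]
    have value_lt : p.value π < 2 * (p.choice j).density * (p.budget - p.cost o) := by
      have value_le : p.value π ≤ (p.state (j + 1)).2.bound +
          (p.choice j).density * (p.budget - p.cost o) :=
        value_le_bound_add_density_mul (p.represents_picked j) _ hπ ho hmax cost_le
      linarith
    have density_pos : 0 < (p.choice j).density := by
      linarith [pos_of_mul_pos_left (value_pos.trans value_lt) room_nonneg]
    obtain ⟨arm_lt, -, gain_eq⟩ := choice_spec density_pos
    rw [state_succ_fst, extendBy, if_pos density_pos] at value_le_bound ⊢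
    rw [picked, if_pos density_pos, card_insert_of_notMem (choice_arm_notMem_picked density_pos),
      card_eq, add_cost, add_value]
    rw [add_value] at value_le_bound
    have ratio_le' : p.value π * ((p.state j).1.cost + p.cost (p.choice j).arm) ≤
        2 * ((p.state j).1.value + p.gain (p.state j).1 (p.choice j).arm) *
          (p.budget - p.cost o) := by
      rw [gain_eq]
      linarith [mul_le_mul_of_nonneg_right value_lt.le (p.cost_pos _ arm_lt).le]
    refine ⟨rfl, le_of_mul_le_mul_left (ratio_le'.trans ?_) value_pos, ratio_le'⟩
    exact mul_le_mul_of_nonneg_right (by linarith) room_nonneg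

theorem value_le_two_mul_value_greedy (hπ : p.IsFeasible π) : p.value π ≤ 2 * p.value p.greedy := by
  by_contra! hlt
  have bound_le : (p.state p.K).2.bound ≤ p.value p.greedy := (p.isSound_state p.K).bound_le
  have greedy_nonneg := p.value_nonneg p.greedy
  obtain ⟨u, -⟩ : (univ : Finset ι).Nonempty := nonempty_of_sum_ne_zero (f := fun u =>
    p.weight u (π u)) (show p.value π ≠ 0 by linarith)
  obtain ⟨o, ho, hmax⟩ :=
    exists_max_image (univ.image π) p.cost ⟨π u, mem_image_of_mem π (mem_univ u)⟩
  have card_eq := (progress_of_two_mul_bound_lt (j := p.K) hπ ho hmax (by linarith)).1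
  have represents := p.represents_picked p.K
  have picked_eq : p.picked p.K = range p.K :=
    eq_of_subset_of_card_le represents.subset (by rw [card_eq, card_range])
  have value_le : p.value π ≤ (p.state p.K).1.value := represents.value_eq ▸ sum_le_sum fun u _ =>
    represents.weight_le _ (picked_eq ▸ mem_range.2 (hπ.lt u)) u
  linarith [p.value_state_le_bound p.K]

end Greedy

end BudgetedAssignment

namespace RealRAM

open CBR Finset

section WeakestPrecondition

/-- Started in `m`, the program `c` halts, and the number of steps and the final memory satisfy
`Q`. -/
def WP (c : Prog) (m : Mem) (Q : ℕ → Mem → Prop) : Prop := ∃ n m', Exec c m n m' ∧ Q n m'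

variable {c c₁ c₂ : Prog} {b : Test} {m : Mem} {a v p N τ : ℕ} {i e : NExp} {r : RExp}
  {Q R : ℕ → Mem → Prop}

theorem WP.mono (h : WP c m Q) (hQR : ∀ n m', Q n m' → R n m') : WP c m R :=
  let ⟨n, m', he, hq⟩ := h
  ⟨n, m', he, hQR n m' hq⟩

theorem wp_skip (h : Q 1 m) : WP .skip m Q :=
  ⟨_, _, .skip m, h⟩

theorem wp_setNat (h : Q (i.steps + e.steps + 1) (m.setNat a (i.eval m) (e.eval m))) :
    WP (.setNat a i e) m Q :=
  ⟨_, _, .setNat a i e m, h⟩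

theorem wp_setReal (h : Q (i.steps + r.steps + 1) (m.setReal a (i.eval m) (r.eval m))) :
    WP (.setReal a i r) m Q :=
  ⟨_, _, .setReal a i r m, h⟩

theorem wp_seq (h : WP c₁ m fun n₁ m₁ => WP c₂ m₁ fun n₂ m₂ => Q (n₁ + n₂ + 1) m₂) :
    WP (.seq c₁ c₂) m Q :=
  let ⟨_, _, he₁, _, _, he₂, hq⟩ := h
  ⟨_, _, .seq he₁ he₂, hq⟩

theorem wp_cond (h₁ : b.holds m → WP c₁ m fun n m' => Q (b.steps + n + 1) m')
    (h₂ : ¬ b.holds m → WP c₂ m fun n m' => Q (b.steps + n + 1) m') : WP (.cond b c₁ c₂) m Q := by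
  by_cases hb : b.holds m
  · obtain ⟨n, m', he, hq⟩ := h₁ hb
    exact ⟨_, _, .condTrue hb he, hq⟩
  · obtain ⟨n, m', he, hq⟩ := h₂ hb
    exact ⟨_, _, .condFalse hb he, hq⟩

/-- Cell `0` of an array of naturals, used as a variable. -/
abbrev natVar (a : ℕ) : NExp := .get a (.lit 0)

/-- Cell `0` of an array of reals, used as a variable. -/
abbrev realVar (a : ℕ) : RExp := .get a (.lit 0)

/-- The test `e₁ < e₂` for reals. -/
abbrev Test.realLt (e₁ e₂ : RExp) : Test := .neg (.realLe e₂ e₁)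

/-- Execute `c` while the variable `v` runs through the numbers below cell `p` of the array `0`. -/
def forLoop (v p : ℕ) (c : Prog) : Prog :=
  .seq (.setNat v (.lit 0) (.lit 0))
    (.loop (.neg (.natLe (.get 0 (.lit p)) (natVar v)))
      (.seq c (.setNat v (.lit 0) (.add (natVar v) (.lit 1)))))

theorem wp_forLoop (Inv : ℕ → Mem → Prop)
    (hInv : ∀ i m, Inv i m → m.nat v 0 = i ∧ m.nat 0 p = N) (hzero : Inv 0 (m.setNat v 0 0))
    (hbody : ∀ i < N, ∀ m, Inv i m → WP c m fun n m' =>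
      n ≤ τ ∧ Inv (i + 1) (m'.setNat v 0 (m'.nat v 0 + 1))) :
    WP (forLoop v p c) m fun n m' => n ≤ N * (τ + 14) + 11 ∧ Inv N m' := by
  have remaining : ∀ d i m, i + d = N → Inv i m →
      WP (.loop (.neg (.natLe (.get 0 (.lit p)) (natVar v)))
        (.seq c (.setNat v (.lit 0) (.add (natVar v) (.lit 1))))) m
        fun n m' => n ≤ d * (τ + 14) + 7 ∧ Inv N m' := by
    intro d
    induction d with
    | zero =>
      rintro i m rfl hi
      obtain ⟨hv, hp⟩ := hInv i m hi
      refine ⟨_, _, .loopStop ?_, ?_, hi⟩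
      · simp [Test.holds, NExp.eval, hv, hp]
      · simp [Test.steps, NExp.steps]
    | succ d ih =>
      intro i m hd hi
      obtain ⟨hv, hp⟩ := hInv i m hi
      obtain ⟨n₁, m₁, he₁, hn₁, hi₁⟩ := hbody i (by omega) m hi
      obtain ⟨n₂, m₂, he₂, hn₂, hi₂⟩ := ih (i + 1) _ (by omega) hi₁
      refine ⟨_, _, .loopStep ?_ (.seq he₁ (.setNat v _ _ _)) he₂, ?_, hi₂⟩
      · simp only [Test.holds, NExp.eval, hv, hp]
        omega
      · simp only [Test.steps, NExp.steps]
        linarith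
  refine wp_seq (wp_setNat ((remaining N 0 _ (by omega) hzero).mono ?_))
  rintro n m' ⟨hn, hi⟩
  refine ⟨?_, hi⟩
  simp only [NExp.steps]
  omega

theorem wp_forLoop_of_eq (s : ℕ → Mem) (hv : v ≠ 0) (hp : ∀ i, (s i).nat 0 p = N)
    (hbody : ∀ i < N, WP c ((s i).setNat v 0 i) fun n m' =>
      n ≤ τ ∧ m' = (s (i + 1)).setNat v 0 i) :
    WP (forLoop v p c) (s 0) fun n m' => n ≤ N * (τ + 14) + 11 ∧ m' = (s N).setNat v 0 N := by
  refine wp_forLoop (fun i m => m = (s i).setNat v 0 i) ?_ rfl ?_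
  · rintro i m rfl
    simp [Mem.setNat, hv.symm, hp]
  · rintro i hi m rfl
    refine (hbody i hi).mono ?_
    rintro n m' ⟨hn, rfl⟩
    simp [hn, Mem.setNat]

end WeakestPrecondition

section Arrays

/-- Overwrite the cells `0, …, n - 1` of the array `a` of naturals with `f 0, …, f (n - 1)`. -/
def Mem.fillNat (m : Mem) (a n : ℕ) (f : ℕ → ℕ) : Mem :=
  { m with nat := Function.update m.nat a fun i => if i < n then f i else m.nat a i }

/-- Overwrite the cells `o, …, o + n - 1` of the array `a` of reals with `f 0, …, f (n - 1)`. -/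
noncomputable def Mem.fillReal (m : Mem) (a o n : ℕ) (f : ℕ → ℝ) : Mem :=
  { m with real := Function.update m.real a fun i =>
      if o ≤ i ∧ i < o + n then f (i - o) else m.real a i }

variable {m : Mem} {a b o n v i j x : ℕ} {y z : ℝ} {f : ℕ → ℕ} {g : ℕ → ℝ}

theorem Mem.ext {m m' : Mem} (hnat : ∀ a i, m.nat a i = m'.nat a i)
    (hreal : ∀ a i, m.real a i = m'.real a i) : m = m' := by
  cases m
  cases m'
  congr
  exacts [funext₂ hnat, funext₂ hreal]

@[simp]
theorem setNat_real : (m.setNat a i x).real = m.real := rfl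

@[simp]
theorem setReal_nat : (m.setReal a i y).nat = m.nat := rfl

@[simp]
theorem fillNat_real : (m.fillNat a n f).real = m.real := rfl

@[simp]
theorem fillReal_nat : (m.fillReal a o n g).nat = m.nat := rfl

@[simp]
theorem setNat_nat_of_ne (h : b ≠ a) : (m.setNat a i x).nat b = m.nat b :=
  Function.update_of_ne h _ _

@[simp]
theorem setReal_real_of_ne (h : b ≠ a) : (m.setReal a i y).real b = m.real b :=
  Function.update_of_ne h _ _

@[simp]
theorem fillNat_nat_of_ne (h : b ≠ a) : (m.fillNat a n f).nat b = m.nat b :=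
  Function.update_of_ne h _ _

@[simp]
theorem fillReal_real_of_ne (h : b ≠ a) : (m.fillReal a o n g).real b = m.real b :=
  Function.update_of_ne h _ _

@[simp]
theorem setNat_nat_self : (m.setNat a i x).nat a j = if j = i then x else m.nat a j := by
  simp [Mem.setNat, Function.update_apply]

@[simp]
theorem setReal_real_self : (m.setReal a i y).real a j = if j = i then y else m.real a j := by
  simp [Mem.setReal, Function.update_apply]

@[simp]
theorem fillNat_nat_self : (m.fillNat a n f).nat a j = if j < n then f j else m.nat a j := by
  simp [Mem.fillNat]

@[simp]
theorem fillReal_real_self :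
    (m.fillReal a o n g).real a j = if o ≤ j ∧ j < o + n then g (j - o) else m.real a j := by
  simp [Mem.fillReal]

theorem fillNat_zero : m.fillNat a 0 f = m := by
  simp [Mem.fillNat]

theorem fillReal_zero : m.fillReal a o 0 g = m := by
  refine Mem.ext (fun _ _ => rfl) fun b j => ?_
  by_cases hb : b = a
  · subst hb
    rw [fillReal_real_self, if_neg (by omega)]
  · rw [fillReal_real_of_ne hb]

theorem setNat_fillNat (n : ℕ) : (m.fillNat a n f).setNat a n (f n) = m.fillNat a (n + 1) f := by
  refine Mem.ext (fun b j => ?_) fun _ _ => rfl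
  by_cases hb : b = a
  · subst hb
    simp only [setNat_nat_self, fillNat_nat_self]
    grind
  · rw [setNat_nat_of_ne hb, fillNat_nat_of_ne hb, fillNat_nat_of_ne hb]

theorem setReal_fillReal (n : ℕ) :
    (m.fillReal a o n g).setReal a (o + n) (g n) = m.fillReal a o (n + 1) g := by
  refine Mem.ext (fun _ _ => rfl) fun b j => ?_
  by_cases hb : b = a
  · subst hb
    simp only [setReal_real_self, fillReal_real_self]
    grind
  · rw [setReal_real_of_ne hb, fillReal_real_of_ne hb, fillReal_real_of_ne hb]

theorem setReal_eq_self (h : m.real a i = y) : m.setReal a i y = m := by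
  simp [Mem.setReal, ← h]

theorem setReal_setReal : (m.setReal a i y).setReal a i z = m.setReal a i z := by
  simp [Mem.setReal]

theorem setNat_comm (h : a ≠ b) {u : ℕ} :
    (m.setNat a i x).setNat b j u = (m.setNat b j u).setNat a i x := by
  simp [Mem.setNat, Function.update_of_ne h, Function.update_of_ne h.symm, Function.update_comm h]

theorem setNat_setReal : (m.setNat a i x).setReal b j y = (m.setReal b j y).setNat a i x := rfl

end Arrays

section FillLoops

variable {c : Prog} {m : Mem} {a v p o N τ : ℕ} {f : ℕ → ℕ} {g : ℕ → ℝ}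

theorem wp_forLoop_fillNat (hv : v ≠ 0) (ha : a ≠ 0) (hav : a ≠ v) (hp : m.nat 0 p = N)
    (hbody : ∀ i < N, ∀ m₁, m₁ = (m.fillNat a i f).setNat v 0 i →
      WP c m₁ fun n m' => n ≤ τ ∧ m' = m₁.setNat a i (f i)) :
    WP (forLoop v p c) m fun n m' =>
      n ≤ N * (τ + 14) + 11 ∧ m' = (m.fillNat a N f).setNat v 0 N := by
  have := wp_forLoop_of_eq (p := p) (m.fillNat a · f) hv (fun _ => by simp [ha.symm, hp])
    fun i hi => (hbody i hi _ rfl).mono fun n m' h => ⟨h.1, h.2.trans ?_⟩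
  · rwa [fillNat_zero] at this
  · rw [setNat_comm hav.symm, setNat_fillNat]

theorem wp_forLoop_fillReal (hv : v ≠ 0) (hp : m.nat 0 p = N)
    (hbody : ∀ i < N, ∀ m₁, m₁ = (m.fillReal a o i g).setNat v 0 i →
      WP c m₁ fun n m' => n ≤ τ ∧ m' = m₁.setReal a (o + i) (g i)) :
    WP (forLoop v p c) m fun n m' =>
      n ≤ N * (τ + 14) + 11 ∧ m' = (m.fillReal a o N g).setNat v 0 N := by
  have := wp_forLoop_of_eq (m.fillReal a o · g) hv (fun _ => hp) fun i hi =>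
    (hbody i hi _ rfl).mono fun n m' h => ⟨h.1, h.2.trans ?_⟩
  · rwa [fillReal_zero] at this
  · rw [← setReal_fillReal]
    rfl

end FillLoops

end RealRAM

namespace RealRAM

open CBR Finset

section Program

/-! Memory layout. Arrays of naturals, besides the parameters (`0`) and the output (`1`). -/

abbrev output : ℕ := 1
/-- The arm that is explored; `K` after the exploration. -/
abbrev explored : ℕ := 2
/-- The number of rounds in which the current arm has been explored. -/
abbrev rounds : ℕ := 3
/-- Cell `k` is `k * U`: there is no multiplication of naturals. -/
abbrev row : ℕ := 4
abbrev user : ℕ := 5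
abbrev step : ℕ := 6
abbrev scanned : ℕ := 7
abbrev levelArm : ℕ := 8
abbrev chosen : ℕ := 9

/-! Arrays of reals, besides the costs (`0`) and the observations (`1`). -/

/-- Cell `k * U + u` is the weight of arm `k` for user `u`. -/
abbrev weights : ℕ := 2
abbrev level : ℕ := 3
abbrev gainSum : ℕ := 4
abbrev totalCost : ℕ := 5
abbrev totalValue : ℕ := 6
abbrev bound : ℕ := 7
abbrev density : ℕ := 8

/-- The real number zero. -/
abbrev zeroR : RExp := .ofNat (.lit 0)

/-- A loop over the users. -/
abbrev forUsers (c : Prog) : Prog := forLoop user 1 c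

/-- The weight for the current user of the arm in the variable `a`. -/
abbrev weightExp (a : ℕ) : RExp := .get weights (.add (.get row (natVar a)) (natVar user))

/-- The level of the current user. -/
abbrev levelExp : RExp := .get level (natVar user)

/-- Fill the array `row`. -/
def rowsP : Prog :=
  .seq (.setNat row (.lit 0) (.lit 0))
    (forLoop scanned 2 (.setNat row (.add (natVar scanned) (.lit 1))
      (.add (.get row (natVar scanned)) (.get 0 (.lit 1)))))

/-- Add the positive parts of the observations to the weights of the explored arm. -/
def recordP : Prog :=
  forUsers (.cond (.realLe zeroR (.get 1 (natVar user)))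
    (.setReal weights (.add (.get row (natVar explored)) (natVar user))
      (.add (weightExp explored) (.get 1 (natVar user))))
    .skip)

/-- The test for `T ^ 2 ≤ n ^ 3`, where `n` is the number of rounds spent on the explored arm. -/
def armDone : Test :=
  .realLe (.mul (.ofNat (.get 0 (.lit 0))) (.ofNat (.get 0 (.lit 0))))
    (.mul (.mul (.ofNat (natVar rounds)) (.ofNat (natVar rounds))) (.ofNat (natVar rounds)))

/-- Explore the same arm again or move on to the next arm. -/
def advanceP : Prog :=
  .seq (.cond armDone
      (.seq (.setNat explored (.lit 0) (.add (natVar explored) (.lit 1)))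
        (.setNat rounds (.lit 0) (.lit 0)))
      .skip)
    (.setNat rounds (.lit 0) (.add (natVar rounds) (.lit 1)))

/-- Match all users to the explored arm. -/
def fillP : Prog := forUsers (.setNat output (natVar user) (natVar explored))

/-- Compute the gain of the arm in the variable `a`. -/
def gainP (a : ℕ) : Prog :=
  .seq (.setReal gainSum (.lit 0) zeroR)
    (forUsers (.cond (.realLe levelExp (weightExp a))
      (.setReal gainSum (.lit 0) (.add (realVar gainSum) (.sub (weightExp a) levelExp)))
      .skip))

/-- Store in the array `t` the arms of the users after adding the arm in the variable `a`. -/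
def switchP (a t : ℕ) : Prog :=
  forUsers (.cond (.realLe levelExp (weightExp a))
    (.setNat t (natVar user) (natVar a))
    (.setNat t (natVar user) (.get levelArm (natVar user))))

/-- The implementation of `BudgetedAssignment.improve`. -/
def improveP : Prog :=
  .cond (.realLt (realVar bound) (.add (realVar totalValue) (realVar gainSum)))
    (.seq (.setReal bound (.lit 0) (.add (realVar totalValue) (realVar gainSum)))
      (switchP scanned output))
    .skip

/-- The gain of the scanned arm per cost. -/
abbrev densityExp : RExp := .div (realVar gainSum) (.get 0 (natVar scanned))

/-- The implementation of `BudgetedAssignment.prefer`. -/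
def preferP : Prog :=
  .cond (.realLt (realVar density) densityExp)
    (.seq (.setReal density (.lit 0) densityExp) (.setNat chosen (.lit 0) (natVar scanned)))
    .skip

/-- Compare the scanned arm with the candidate and with the stored choice. -/
def compareP : Prog := .seq (gainP scanned) (.seq improveP preferP)

/-- The test whether the scanned arm fits into the budget. -/
def fits : Test :=
  .realLe (.add (.get 0 (natVar scanned)) (realVar totalCost)) (.ofNat (.get 0 (.lit 3)))

/-- The implementation of `BudgetedAssignment.scan`. -/
def scanP : Prog :=
  .seq (.setReal density (.lit 0) zeroR)
    (.seq (.setNat chosen (.lit 0) (.lit 0)) (forLoop scanned 2 (.cond fits compareP .skip)))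

/-- Raise the levels of the users to their weights for the chosen arm. -/
def raiseP : Prog :=
  forUsers (.cond (.realLe levelExp (weightExp chosen))
    (.setReal level (natVar user) (weightExp chosen)) .skip)

/-- The implementation of `BudgetedAssignment.add`. -/
def addP : Prog :=
  .seq (gainP chosen)
    (.seq (switchP chosen levelArm)
      (.seq raiseP
        (.seq (.setReal totalCost (.lit 0) (.add (realVar totalCost) (.get 0 (natVar chosen))))
          (.setReal totalValue (.lit 0) (.add (realVar totalValue) (realVar gainSum))))))

/-- The implementation of `BudgetedAssignment.extendBy`. -/
def extendP : Prog := .cond (.realLt zeroR (realVar density)) addP .skip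

/-- Match all users to the arm `0` in the array `t`. -/
def clearP (t : ℕ) : Prog := forUsers (.setNat t (natVar user) (.lit 0))

/-- Set all levels to zero. -/
def groundP : Prog := forUsers (.setReal level (natVar user) zeroR)

/-- Write the initial state of the greedy algorithm to the memory. -/
def resetP : Prog :=
  .seq groundP
    (.seq (clearP levelArm)
      (.seq (clearP output)
        (.seq (.setReal totalCost (.lit 0) zeroR)
          (.seq (.setReal totalValue (.lit 0) zeroR) (.setReal bound (.lit 0) zeroR)))))

/-- The implementation of `BudgetedAssignment.greedy`. -/
def greedyP : Prog := .seq resetP (forLoop step 2 (.seq scanP extendP))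

/-- Take the observations of the last round into account. -/
def updateP : Prog :=
  .cond (.natLe (.get 0 (.lit 2)) (natVar explored)) .skip (.seq recordP advanceP)

/-- Compute the matching of the round. -/
def actP : Prog := .cond (.natLe (.get 0 (.lit 2)) (natVar explored)) greedyP fillP

/-- The program that is executed in each round. -/
def banditP : Prog := .seq rowsP (.seq updateP actP)

end Program

end RealRAM

namespace RealRAM

open CBR Finset

section UserLoops

variable {m : Mem} {U K a : ℕ}

theorem wp_rowsP (hU : m.nat 0 1 = U) (hK : m.nat 0 2 = K) :
    WP rowsP m fun n m' => n ≤ K * 49 + 15 ∧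
      m' = (m.fillNat row (K + 1) fun k => k * U).setNat scanned 0 K := by
  have := wp_forLoop_of_eq
    (c := .setNat row (.add (natVar scanned) (.lit 1))
      (.add (.get row (natVar scanned)) (.get 0 (.lit 1)))) (τ := 35)
    (fun i => m.fillNat row (i + 1) fun k => k * U)
    (show scanned ≠ 0 by decide) (p := 2) (N := K) (by simpa) fun i _ => wp_setNat ⟨?_, ?_⟩
  · refine wp_seq (wp_setNat ?_)
    have first : m.setNat row 0 0 = m.fillNat row 1 fun k => k * U := by
      simpa [fillNat_zero] using setNat_fillNat (m := m) (a := row) (f := fun k => k * U) 0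
    simp only [NExp.eval, NExp.steps, first]
    exact this.mono fun n m' h => ⟨by omega, h.2⟩
  · simp [NExp.steps]
  · rw [setNat_comm (by decide), ← setNat_fillNat (i + 1)]
    simp [NExp.eval, hU, Nat.succ_mul]

theorem wp_recordP (hU : m.nat 0 1 = U) :
    WP recordP m fun n m' => n ≤ U * 49 + 11 ∧
      m' = (m.fillReal weights (m.nat row (m.nat explored 0)) U fun u =>
        m.real weights (m.nat row (m.nat explored 0) + u) + max 0 (m.real 1 u)).setNat
          user 0 U := by
  refine wp_forLoop_fillReal (τ := 35) (by decide) hU fun i _ m₁ hm₁ => wp_cond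
    (fun h => wp_setReal ⟨by simp [RExp.steps, Test.steps, NExp.steps], ?_⟩)
    fun h => wp_skip ⟨by simp [RExp.steps, Test.steps, NExp.steps], (setReal_eq_self ?_).symm⟩
  · simp_all [Test.holds, RExp.eval, NExp.eval]
  · simp_all [Test.holds, RExp.eval, NExp.eval, le_of_lt]

theorem wp_fillP (hU : m.nat 0 1 = U) :
    WP fillP m fun n m' => n ≤ U * 49 + 11 ∧
      m' = (m.fillNat output U fun _ => m.nat explored 0).setNat user 0 U :=
  wp_forLoop_fillNat (τ := 35) (by decide) (by decide) (by decide) hU fun i _ m₁ hm₁ =>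
    wp_setNat ⟨by simp [NExp.steps], by simp [NExp.eval, hm₁]⟩

theorem wp_gainP (ha : a ≠ user) (hU : m.nat 0 1 = U) :
    WP (gainP a) m fun n m' => n ≤ U * 49 + 16 ∧
      m' = (m.setReal gainSum 0 (∑ u ∈ range U,
        max 0 (m.real weights (m.nat row (m.nat a 0) + u) - m.real level u))).setNat user 0 U := by
  have := wp_forLoop_of_eq
    (c := .cond (.realLe levelExp (weightExp a))
      (.setReal gainSum (.lit 0) (.add (realVar gainSum) (.sub (weightExp a) levelExp))) .skip)
    (τ := 35)
    (fun i => m.setReal gainSum 0 (∑ u ∈ range i,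
        max 0 (m.real weights (m.nat row (m.nat a 0) + u) - m.real level u)))
    (show user ≠ 0 by decide) (fun _ => hU) fun i _ => wp_cond (fun h => wp_setReal ⟨?_, ?_⟩)
    fun h => wp_skip ⟨?_, ?_⟩
  · refine wp_seq (wp_setReal ?_)
    simp only [range_zero, sum_empty] at this
    simp only [NExp.eval, RExp.eval, Nat.cast_zero, NExp.steps, RExp.steps]
    exact this.mono fun n m' h => ⟨by omega, h.2⟩
  · simp [RExp.steps, Test.steps, NExp.steps]
  · simp_all [Test.holds, RExp.eval, NExp.eval, sum_range_succ, ← setNat_setReal, setReal_setReal]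
  · simp [RExp.steps, Test.steps, NExp.steps]
  · simp_all [Test.holds, RExp.eval, NExp.eval, sum_range_succ, le_of_lt]

theorem wp_switchP {t : ℕ} (ht : t ≠ 0) (htu : t ≠ user) (hta : t ≠ a) (htr : t ≠ row)
    (hau : a ≠ user) (hU : m.nat 0 1 = U) :
    WP (switchP a t) m fun n m' => n ≤ U * 49 + 11 ∧ m' = (m.fillNat t U fun u =>
      if m.real level u ≤ m.real weights (m.nat row (m.nat a 0) + u) then m.nat a 0
      else m.nat levelArm u).setNat user 0 U := by
  refine wp_forLoop_fillNat (τ := 35) (by decide) ht htu hU fun i _ m₁ hm₁ => ?_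
  have arm_eq : m₁.nat levelArm i = m.nat levelArm i := by
    by_cases h : levelArm = t
    · simp [hm₁, ← h]
    · simp [hm₁, h]
  have user_eq : m₁.nat user 0 = i := by simp [hm₁]
  have hold : (Test.realLe levelExp (weightExp a)).holds m₁ ↔
      m.real level i ≤ m.real weights (m.nat row (m.nat a 0) + i) := by
    simp [Test.holds, RExp.eval, NExp.eval, hm₁, hta.symm, htr.symm, hau]
  refine wp_cond (fun h => wp_setNat ⟨by simp [RExp.steps, Test.steps, NExp.steps], ?_⟩)
    fun h => wp_setNat ⟨by simp [RExp.steps, Test.steps, NExp.steps], ?_⟩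
  · rw [if_pos (hold.1 h)]
    simp [NExp.eval, hm₁, hta.symm, hau]
  · rw [if_neg (mt hold.2 h)]
    simp only [NExp.eval, user_eq, arm_eq]

theorem wp_raiseP (hU : m.nat 0 1 = U) :
    WP raiseP m fun n m' => n ≤ U * 49 + 11 ∧ m' = (m.fillReal level 0 U fun u =>
      max (m.real level u) (m.real weights (m.nat row (m.nat chosen 0) + u))).setNat user 0 U := by
  refine wp_forLoop_fillReal (τ := 35) (by decide) hU fun i _ m₁ hm₁ => wp_cond
    (fun h => wp_setReal ⟨by simp [RExp.steps, Test.steps, NExp.steps], ?_⟩)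
    fun h => wp_skip ⟨by simp [RExp.steps, Test.steps, NExp.steps], (setReal_eq_self ?_).symm⟩
  · simp_all [Test.holds, RExp.eval, NExp.eval]
  · simp_all [Test.holds, RExp.eval, NExp.eval, le_of_lt]

theorem wp_groundP (hU : m.nat 0 1 = U) :
    WP groundP m fun n m' => n ≤ U * 49 + 11 ∧
      m' = (m.fillReal level 0 U fun _ => 0).setNat user 0 U :=
  wp_forLoop_fillReal (τ := 35) (by decide) hU fun i _ m₁ hm₁ =>
    wp_setReal ⟨by simp [RExp.steps, NExp.steps], by simp [RExp.eval, NExp.eval, hm₁]⟩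

theorem wp_clearP {t : ℕ} (ht : t ≠ 0) (htu : t ≠ user) (hU : m.nat 0 1 = U) :
    WP (clearP t) m fun n m' => n ≤ U * 49 + 11 ∧
      m' = (m.fillNat t U fun _ => 0).setNat user 0 U :=
  wp_forLoop_fillNat (τ := 35) (by decide) ht htu hU fun i _ m₁ hm₁ =>
    wp_setNat ⟨by simp [NExp.steps], by simp [NExp.eval, hm₁]⟩

end UserLoops

end RealRAM

namespace RealRAM

open CBR Finset BudgetedAssignment

section Frame

/-- The arrays of naturals that a program may write to. -/
def Prog.natWrites : Prog → Finset ℕ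
  | skip | setReal _ _ _ => ∅
  | setNat a _ _ => {a}
  | seq c₁ c₂ | cond _ c₁ c₂ => c₁.natWrites ∪ c₂.natWrites
  | loop _ c => c.natWrites

/-- The arrays of reals that a program may write to. -/
def Prog.realWrites : Prog → Finset ℕ
  | skip | setNat _ _ _ => ∅
  | setReal a _ _ => {a}
  | seq c₁ c₂ | cond _ c₁ c₂ => c₁.realWrites ∪ c₂.realWrites
  | loop _ c => c.realWrites

variable {c : Prog} {m m' : Mem} {n a : ℕ} {Q : ℕ → Mem → Prop}

theorem Exec.nat_eq (h : Exec c m n m') (ha : a ∉ c.natWrites) : m'.nat a = m.nat a := by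
  induction h <;> simp_all [Prog.natWrites]

theorem Exec.real_eq (h : Exec c m n m') (ha : a ∉ c.realWrites) : m'.real a = m.real a := by
  induction h <;> simp_all [Prog.realWrites]

/-- The memories `m` and `m'` agree on the arrays outside `N` and `R`. -/
def AgreeOff (N R : Finset ℕ) (m m' : Mem) : Prop :=
  (∀ a ∉ N, m'.nat a = m.nat a) ∧ ∀ a ∉ R, m'.real a = m.real a

theorem WP.frame (h : WP c m Q) :
    WP c m fun n m' => Q n m' ∧ AgreeOff c.natWrites c.realWrites m m' :=
  let ⟨n, m', he, hq⟩ := h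
  ⟨n, m', he, hq, fun _ => he.nat_eq, fun _ => he.real_eq⟩

end Frame

section Greedy

variable {U : ℕ}

/-- The memory contains the assignment problem `p`. -/
structure Encodes (p : BudgetedAssignment (Fin U)) (m : Mem) : Prop where
  users : m.nat 0 1 = U
  arms : m.nat 0 2 = p.K
  budget : (m.nat 0 3 : ℝ) = p.budget
  cost : ∀ k < p.K, m.real 0 k = p.cost k
  weight : ∀ k < p.K, ∀ u : Fin U, m.real weights (m.nat row k + u) = p.weight u k

/-- The selection that is stored in the memory. -/
def selection (U : ℕ) (m : Mem) : Selection (Fin U) :=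
  ⟨fun u => m.real level u, fun u => m.nat levelArm u, m.real totalCost 0, m.real totalValue 0⟩

/-- The candidate that is stored in the memory. -/
def candidate (U : ℕ) (m : Mem) : Candidate (Fin U) := ⟨fun u => m.nat output u, m.real bound 0⟩

/-- The choice that is stored in the memory. -/
def storedChoice (m : Mem) : Choice := ⟨m.nat chosen 0, m.real density 0⟩

variable {p : BudgetedAssignment (Fin U)} {m m' : Mem} {a j : ℕ}

theorem Encodes.of_agreeOff {N R : Finset ℕ} (h : Encodes p m) (hm : AgreeOff N R m m')
    (hN : Disjoint {0, row} N) (hR : Disjoint {0, weights} R) : Encodes p m' := by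
  simp only [disjoint_insert_left, disjoint_singleton_left] at hN hR
  obtain ⟨h₁, h₂, h₃, h₄, h₅⟩ := h
  constructor <;> simpa only [hm.1 _ hN.1, hm.1 _ hN.2, hm.2 _ hR.1, hm.2 _ hR.2]

theorem selection_of_agreeOff {N R : Finset ℕ} (hm : AgreeOff N R m m') (hN : levelArm ∉ N)
    (hR : Disjoint {level, totalCost, totalValue} R) : selection U m' = selection U m := by
  simp only [disjoint_insert_left, disjoint_singleton_left] at hR
  simp only [selection, hm.1 _ hN, hm.2 _ hR.1, hm.2 _ hR.2.1, hm.2 _ hR.2.2]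

theorem candidate_of_agreeOff {N R : Finset ℕ} (hm : AgreeOff N R m m') (hN : output ∉ N)
    (hR : bound ∉ R) : candidate U m' = candidate U m := by
  simp only [candidate, hm.1 _ hN, hm.2 _ hR]

theorem storedChoice_of_agreeOff {N R : Finset ℕ} (hm : AgreeOff N R m m') (hN : chosen ∉ N)
    (hR : density ∉ R) : storedChoice m' = storedChoice m := by
  simp only [storedChoice, hm.1 _ hN, hm.2 _ hR]

theorem wp_gainP_of_encodes (h : Encodes p m) (ha : a ≠ user) (hk : m.nat a 0 < p.K) :
    WP (gainP a) m fun n m' => n ≤ U * 49 + 16 ∧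
      m' = (m.setReal gainSum 0 (p.gain (selection U m) (m.nat a 0))).setNat user 0 U := by
  refine (wp_gainP ha h.users).mono fun n m' h' => ⟨h'.1, ?_⟩
  rw [h'.2, sum_range]
  simp only [gain, selection, h.weight _ hk]

theorem wp_switchP_of_encodes {t : ℕ} (h : Encodes p m) (ht : t ≠ 0) (htu : t ≠ user)
    (hta : t ≠ a) (htr : t ≠ row) (hau : a ≠ user) (hk : m.nat a 0 < p.K) :
    WP (switchP a t) m fun n m' => n ≤ U * 49 + 11 ∧
      ∀ u : Fin U, m'.nat t u = p.switch (selection U m) (m.nat a 0) u := by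
  refine (wp_switchP ht htu hta htr hau h.users).mono fun n m' h' => ⟨h'.1, fun u => ?_⟩
  rw [h'.2, setNat_nat_of_ne htu, fillNat_nat_self, if_pos u.2, h.weight _ hk]
  rfl

theorem wp_improveP (h : Encodes p m) (hk : m.nat scanned 0 < p.K)
    (hg : m.real gainSum 0 = p.gain (selection U m) (m.nat scanned 0)) :
    WP improveP m fun n m' => n ≤ U * 49 + 40 ∧
      candidate U m' = p.improve (selection U m) (m.nat scanned 0) (candidate U m) := by
  have hold : (Test.realLt (realVar bound) (.add (realVar totalValue) (realVar gainSum))).holds m ↔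
      (candidate U m).bound <
        (selection U m).value + p.gain (selection U m) (m.nat scanned 0) := by
    simp only [Test.holds, RExp.eval, NExp.eval, hg, not_le]
    rfl
  refine wp_cond (fun hb => wp_seq <| wp_setReal ?_) fun hb => wp_skip ⟨?_, ?_⟩
  · have h₁ : Encodes p (m.setReal bound 0 (m.real totalValue 0 + m.real gainSum 0)) :=
      ⟨h.users, h.arms, h.budget, h.cost, h.weight⟩
    refine (wp_switchP_of_encodes (t := output) (a := scanned) h₁ (by decide) (by decide)
      (by decide) (by decide) (by decide) hk).frame.mono ?_
    rintro n m' ⟨⟨hn, hswitch⟩, -, hreal⟩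
    refine ⟨?_, ?_⟩
    · simp only [NExp.steps, RExp.steps, Test.steps]
      linarith [hn]
    · rw [improve, if_pos (hold.1 hb)]
      refine Candidate.ext (funext hswitch) ?_
      simp only [candidate, hreal bound (by decide), setReal_real_self, hg]
      rfl
  · simp only [NExp.steps, RExp.steps, Test.steps]
    omega
  · rw [improve, if_neg (mt hold.2 hb)]

theorem wp_preferP (h : Encodes p m) (hk : m.nat scanned 0 < p.K)
    (hg : m.real gainSum 0 = p.gain (selection U m) (m.nat scanned 0)) :
    WP preferP m fun n m' => n ≤ 40 ∧
      storedChoice m' = p.prefer (selection U m) (m.nat scanned 0) (storedChoice m) := by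
  have hold : (Test.realLt (realVar density) densityExp).holds m ↔ (storedChoice m).density <
      p.gain (selection U m) (m.nat scanned 0) / p.cost (m.nat scanned 0) := by
    simp only [Test.holds, RExp.eval, NExp.eval, hg, h.cost _ hk, not_le]
    rfl
  refine wp_cond (fun hb => wp_seq <| wp_setReal <| wp_setNat ⟨?_, ?_⟩) fun hb => wp_skip ⟨?_, ?_⟩
  · simp [NExp.steps, RExp.steps, Test.steps]
  · rw [prefer, if_pos (hold.1 hb)]
    simp [storedChoice, NExp.eval, RExp.eval, hg, h.cost _ hk]
  · simp [NExp.steps, RExp.steps, Test.steps]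
  · rw [prefer, if_neg (mt hold.2 hb)]

theorem wp_compareP (h : Encodes p m) (hk : m.nat scanned 0 < p.K) :
    WP compareP m fun n m' => n ≤ U * 98 + 100 ∧
      candidate U m' = p.improve (selection U m) (m.nat scanned 0) (candidate U m) ∧
        storedChoice m' = p.prefer (selection U m) (m.nat scanned 0) (storedChoice m) := by
  refine wp_seq <| (wp_gainP_of_encodes h (by decide) hk).mono fun n₁ m₁ ⟨hn₁, hm₁⟩ => ?_
  have h₁ : Encodes p m₁ := hm₁ ▸ ⟨h.users, h.arms, h.budget, h.cost, h.weight⟩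
  have hs₁ : selection U m₁ = selection U m := hm₁ ▸ rfl
  have hc₁ : candidate U m₁ = candidate U m := hm₁ ▸ rfl
  have hd₁ : storedChoice m₁ = storedChoice m := hm₁ ▸ rfl
  have hk₁ : m₁.nat scanned 0 = m.nat scanned 0 := hm₁ ▸ rfl
  have hg₁ : m₁.real gainSum 0 = p.gain (selection U m₁) (m₁.nat scanned 0) := by
    rw [hs₁, hk₁, hm₁]
    simp
  refine wp_seq <| (wp_improveP h₁ (hk₁ ▸ hk) hg₁).frame.mono fun n₂ m₂ ⟨⟨hn₂, hc₂⟩, hm₂⟩ => ?_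
  have hs₂ : selection U m₂ = selection U m₁ := selection_of_agreeOff hm₂ (by decide) (by decide)
  have hd₂ : storedChoice m₂ = storedChoice m₁ :=
    storedChoice_of_agreeOff hm₂ (by decide) (by decide)
  have hk₂ : m₂.nat scanned 0 = m₁.nat scanned 0 := congrFun (hm₂.1 _ (by decide)) 0
  have hg₂ : m₂.real gainSum 0 = p.gain (selection U m₂) (m₂.nat scanned 0) := by
    rw [hs₂, hk₂, ← hg₁, hm₂.2 _ (by decide)]
  have h₂ : Encodes p m₂ := h₁.of_agreeOff hm₂ (by decide) (by decide)
  refine (wp_preferP h₂ (hk₂ ▸ hk₁ ▸ hk) hg₂).frame.mono fun n₃ m₃ ⟨⟨hn₃, hd₃⟩, hm₃⟩ =>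
    ⟨by linarith [hn₁, hn₂, hn₃], ?_, ?_⟩
  · rw [candidate_of_agreeOff hm₃ (by decide) (by decide), hc₂, hs₁, hk₁, hc₁]
  · rw [hd₃, hs₂, hs₁, hk₂, hk₁, hd₂, hd₁]

theorem fits_holds (h : Encodes p m) (hk : m.nat scanned 0 < p.K) :
    fits.holds m ↔ p.cost (m.nat scanned 0) + (selection U m).cost ≤ p.budget := by
  simp only [fits, Test.holds, RExp.eval, NExp.eval, h.cost _ hk, h.budget]
  rfl

theorem wp_scanP (h : Encodes p m) :
    WP scanP m fun n m' => n ≤ p.K * (U * 98 + 125) + 23 ∧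
      (candidate U m', storedChoice m') = p.scan (selection U m) (candidate U m) p.K := by
  let Inv : ℕ → Mem → Prop := fun i m' => (m'.nat scanned 0 = i ∧ Encodes p m') ∧
    selection U m' = selection U m ∧
      (candidate U m', storedChoice m') = p.scan (selection U m) (candidate U m) i
  have hloop := wp_forLoop (v := scanned) (p := 2) (N := p.K) (τ := U * 98 + 111)
    (c := .cond fits compareP .skip) (m := (m.setReal density 0 0).setNat chosen 0 0) Inv
    (fun i m' hi => ⟨hi.1.1, hi.1.2.arms⟩) ?_ ?_
  · refine wp_seq <| wp_setReal <| wp_seq <| wp_setNat ?_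
    simp only [RExp.eval, NExp.eval, Nat.cast_zero]
    refine hloop.mono fun n m' ⟨hn, hi⟩ => ⟨?_, hi.2.2⟩
    simp only [NExp.steps, RExp.steps]
    linarith [hn]
  · exact ⟨⟨rfl, h.users, h.arms, h.budget, h.cost, h.weight⟩, rfl, by
      simp [candidate, storedChoice, scan]⟩
  · rintro i hi m₁ ⟨⟨hk, h₁⟩, hs, hx⟩
    subst hk
    rw [Prod.ext_iff] at hx
    have step : WP (.cond fits compareP .skip) m₁ fun n m' => n ≤ U * 98 + 111 ∧
      (candidate U m', storedChoice m') =
        p.scan (selection U m) (candidate U m) (m₁.nat scanned 0 + 1) := by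
      rw [scan, ← hx.1, ← hx.2, ← hs]
      refine wp_cond (fun hb => ?_) fun hb => wp_skip ⟨?_, ?_⟩
      · refine (wp_compareP h₁ hi).mono fun n m' ⟨hn, hc, hd⟩ => ⟨?_, ?_⟩
        · simp only [fits, Test.steps, RExp.steps, NExp.steps]
          linarith [hn]
        · rw [if_pos ((fits_holds h₁ hi).1 hb), hc, hd]
      · simp [fits, Test.steps, RExp.steps, NExp.steps]
      · rw [if_neg (mt (fits_holds h₁ hi).2 hb), hs]
        exact Prod.ext hx.1 hx.2
    refine step.frame.mono fun n m' ⟨⟨hn, hx'⟩, hm'⟩ => ⟨hn, ?_⟩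
    have h' := h₁.of_agreeOff hm' (by decide) (by decide)
    have hk' : m'.nat scanned 0 = m₁.nat scanned 0 := congrFun (hm'.1 _ (by decide)) 0
    refine ⟨⟨by simp [hk'], h'.users, h'.arms, h'.budget, h'.cost, h'.weight⟩, ?_, hx'⟩
    exact (selection_of_agreeOff hm' (by decide) (by decide)).trans hs

theorem wp_addP (h : Encodes p m) (hk : m.nat chosen 0 < p.K) :
    WP addP m fun n m' => n ≤ U * 147 + 60 ∧
      selection U m' = p.add (selection U m) (m.nat chosen 0) := by
  refine wp_seq <| (wp_gainP_of_encodes h (by decide) hk).mono fun n₁ m₁ ⟨hn₁, hm₁⟩ => ?_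
  have h₁ : Encodes p m₁ := hm₁ ▸ ⟨h.users, h.arms, h.budget, h.cost, h.weight⟩
  have hk₁ : m₁.nat chosen 0 = m.nat chosen 0 := hm₁ ▸ rfl
  refine wp_seq <| (wp_switchP_of_encodes (t := levelArm) (a := chosen) h₁ (by decide) (by decide)
    (by decide) (by decide) (by decide) (hk₁ ▸ hk)).frame.mono
      fun n₂ m₂ ⟨⟨hn₂, arm_eq⟩, hm₂⟩ => ?_
  have h₂ : Encodes p m₂ := h₁.of_agreeOff hm₂ (by decide) (by decide)
  have hk₂ : m₂.nat chosen 0 = m.nat chosen 0 := hk₁ ▸ congrFun (hm₂.1 _ (by decide)) 0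
  refine wp_seq <| (wp_raiseP h₂.users).mono fun n₃ m₃ ⟨hn₃, hm₃⟩ =>
    wp_seq <| wp_setReal <| wp_setReal ⟨?_, ?_⟩
  · simp only [NExp.steps, RExp.steps]
    linarith [hn₁, hn₂, hn₃]
  · have real_eq (a : ℕ) (ha : a ≠ gainSum) : m₂.real a = m.real a := by
      rw [hm₂.2 _ (notMem_empty a), hm₁, setNat_real, setReal_real_of_ne ha]
    have gain_eq : m₂.real gainSum 0 = p.gain (selection U m) (m.nat chosen 0) := by
      rw [hm₂.2 _ (by decide), hm₁]
      simp
    have weight_eq (u : Fin U) : m₂.real weights (m₂.nat row (m₂.nat chosen 0) + u) =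
        p.weight u (m.nat chosen 0) := by
      rw [h₂.weight _ (hk₂ ▸ hk), hk₂]
    have hs₁ : selection U m₁ = selection U m := hm₁ ▸ rfl
    rw [hs₁, hk₁] at arm_eq
    simp only [hm₃, RExp.eval, NExp.eval]
    refine Selection.ext (funext fun u => ?_) (funext fun u => ?_) ?_ ?_
    · simp [selection, weight_eq, real_eq level (by decide)]
    · simp [selection, arm_eq u]
    · simp [selection, hk₂, real_eq totalCost (by decide), real_eq 0 (by decide), h.cost _ hk]
    · simp [selection, gain_eq, real_eq totalValue (by decide)]

theorem wp_extendP (h : Encodes p m) (hk : 0 < m.real density 0 → m.nat chosen 0 < p.K) :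
    WP extendP m fun n m' => n ≤ U * 147 + 70 ∧
      selection U m' = p.extendBy (selection U m) (storedChoice m) := by
  have hold : (Test.realLt zeroR (realVar density)).holds m ↔ 0 < (storedChoice m).density := by
    simp [Test.holds, RExp.eval, NExp.eval, storedChoice]
  refine wp_cond (fun hb => ?_) fun hb => wp_skip ⟨?_, ?_⟩
  · rw [extendBy, if_pos (hold.1 hb)]
    refine (wp_addP h (hk (hold.1 hb))).mono fun n m' ⟨hn, hs⟩ => ⟨?_, hs⟩
    simp only [Test.steps, RExp.steps, NExp.steps]
    linarith [hn]
  · simp [Test.steps, RExp.steps, NExp.steps]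
  · rw [extendBy, if_neg (mt hold.2 hb)]

theorem wp_resetP (h : Encodes p m) :
    WP resetP m fun n m' => n ≤ U * 147 + 60 ∧ (selection U m', candidate U m') = p.state 0 := by
  refine wp_seq <| (wp_groundP h.users).mono fun n₁ m₁ h₁ => ?_
  have users₁ : m₁.nat 0 1 = U := h₁.2 ▸ h.users
  refine wp_seq <| (wp_clearP (t := levelArm) (by decide) (by decide) users₁).mono
    fun n₂ m₂ h₂ => ?_
  have users₂ : m₂.nat 0 1 = U := by
    rw [h₂.2, h₁.2]
    exact h.users
  refine wp_seq <| (wp_clearP (t := output) (by decide) (by decide) users₂).mono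
    fun n₃ m₃ h₃ => wp_seq <| wp_setReal <| wp_seq <| wp_setReal <| wp_setReal ⟨?_, ?_⟩
  · simp only [NExp.steps, RExp.steps]
    linarith [h₁.1, h₂.1, h₃.1]
  · rw [h₃.2, h₂.2, h₁.2]
    refine Prod.ext (Selection.ext (funext fun u => ?_) (funext fun u => ?_) ?_ ?_)
      (Candidate.ext (funext fun u => ?_) ?_) <;>
      simp [selection, candidate, state, RExp.eval, NExp.eval]

theorem wp_greedyStep (h : Encodes p m) (hx : (selection U m, candidate U m) = p.state j) :
    WP (.seq scanP extendP) m fun n m' => n ≤ p.K * (U * 98 + 125) + U * 147 + 94 ∧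
      (selection U m', candidate U m') = p.state (j + 1) := by
  have hs : selection U m = (p.state j).1 := congrArg Prod.fst hx
  have hc : candidate U m = (p.state j).2 := congrArg Prod.snd hx
  refine wp_seq <| (wp_scanP h).frame.mono fun n₁ m₁ h₁ => ?_
  have hs₁ := selection_of_agreeOff (U := U) h₁.2 (by decide) (by decide)
  have hscan := h₁.1.2
  rw [hs, hc] at hscan
  have hchoice : storedChoice m₁ = p.choice j := congrArg Prod.snd hscan
  have hk : 0 < m₁.real density 0 → m₁.nat chosen 0 < p.K := fun hd =>
    (congrArg Choice.arm hchoice).trans_lt (choice_spec (hchoice ▸ hd)).1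
  refine (wp_extendP (h.of_agreeOff h₁.2 (by decide) (by decide)) hk).frame.mono
    fun n₂ m₂ h₂ => ⟨by linarith [h₁.1.1, h₂.1.1], Prod.ext ?_ ?_⟩
  · rw [h₂.1.2, hs₁, hs, hchoice, state_succ_fst]
  · rw [candidate_of_agreeOff h₂.2 (by decide) (by decide)]
    exact congrArg Prod.fst hscan

theorem wp_greedyP (h : Encodes p m) :
    WP greedyP m fun n m' => n ≤ p.K * (p.K * (U * 98 + 125) + U * 147 + 110) + U * 147 + 80 ∧
      ∀ u : Fin U, m'.nat output u = p.greedy u := by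
  let Inv : ℕ → Mem → Prop := fun j m' => (m'.nat step 0 = j ∧ Encodes p m') ∧
    (selection U m', candidate U m') = p.state j
  refine wp_seq <| (wp_resetP h).frame.mono fun n₁ m₁ ⟨⟨_, hx₁⟩, hm₁⟩ => ?_
  have h₁ := h.of_agreeOff hm₁ (by decide) (by decide)
  refine (wp_forLoop (v := step) (p := 2) (N := p.K) (τ := p.K * (U * 98 + 125) + U * 147 + 94)
    (c := .seq scanP extendP) Inv (fun i m' hi => ⟨hi.1.1, hi.1.2.arms⟩)
    ⟨⟨rfl, h₁.users, h₁.arms, h₁.budget, h₁.cost, h₁.weight⟩, hx₁⟩ ?_).mono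
      fun n₂ m₂ ⟨_, hi₂⟩ => ⟨by linarith, fun u => ?_⟩
  · rintro j - m ⟨⟨rfl, h⟩, hx⟩
    refine (wp_greedyStep h hx).frame.mono fun n m' ⟨⟨hn, hx'⟩, hm'⟩ => ⟨hn, ⟨?_, ?_⟩, hx'⟩
    · simp [congrFun (hm'.1 step (by decide)) 0]
    · have h' := h.of_agreeOff hm' (by decide) (by decide)
      exact ⟨h'.users, h'.arms, h'.budget, h'.cost, h'.weight⟩
  · exact congrArg (fun s => s.2.assignment u) hi₂.2

end Greedy

end RealRAM

namespace CBR

open Finset BudgetedAssignment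

section Learner

variable {P : Params}

/-- The number of rounds in which each arm is explored. -/
noncomputable def Params.exploreLength (P : Params) : ℕ := ⌈(P.T : ℝ) ^ (2 / 3 : ℝ)⌉₊

theorem Params.T_pos (P : Params) : 0 < P.T := P.U_pos.trans_le P.U_le_T

theorem Params.exploreLength_pos (P : Params) : 0 < P.exploreLength :=
  Nat.ceil_pos.2 <| Real.rpow_pos_of_pos (Nat.cast_pos.2 P.T_pos) _

/-- The total reward of user `u` from arm `k` in the exploration. Rewards are almost surely
nonnegative; taking positive parts makes the sums nonnegative for all observations. -/
noncomputable def exploredSum : List (Obs P) → Fin P.U → ℕ → ℝ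
  | [], _, _ => 0
  | x :: h, u, k =>
    exploredSum h u k + if h.length / P.exploreLength = k then max 0 (x u) else 0

theorem exploredSum_nonneg (h : List (Obs P)) (u : Fin P.U) (k : ℕ) : 0 ≤ exploredSum h u k := by
  induction h with
  | nil => exact le_rfl
  | cons x h ih =>
    refine add_nonneg ih ?_
    split_ifs
    exacts [le_max_left _ _, le_rfl]

/-- The problem of matching the users after the observations `h`. -/
@[simps]
noncomputable def exploredAssignment (h : List (Obs P)) : BudgetedAssignment (Fin P.U) where
  K := P.K
  weight := exploredSum h
  cost k := if hk : k < P.K then P.cost ⟨k, hk⟩ else 0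
  budget := P.B
  K_pos := P.K_pos
  weight_nonneg := exploredSum_nonneg h
  cost_pos k hk := by simpa only [hk, dif_pos] using P.cost_pos _
  cost_le k hk := by simpa only [hk, dif_pos] using P.cost_le _

theorem isFeasible_exploredAssignment_iff {h : List (Obs P)} {π : Matching P} :
    (exploredAssignment h).IsFeasible (fun u => π u) ↔ Feasible P π := by
  have cost_eq : ∑ k ∈ univ.image fun u => (π u : ℕ), (exploredAssignment h).cost k =
      ∑ k ∈ univ.image π, P.cost k := by
    rw [← Function.comp_def Fin.val π, ← image_image, sum_image Fin.val_injective.injOn]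
    simp
  exact ⟨fun hπ => cost_eq.symm.trans_le hπ.cost_le,
    fun hπ => ⟨fun u => (π u).2, cost_eq.trans_le hπ⟩⟩

/-- The learner that explores all arms one after the other and then matches the users by the greedy
algorithm. -/
noncomputable def exploreThenCommit (P : Params) : Learner P := fun h u =>
  if hk : h.length / P.exploreLength < P.K then ⟨h.length / P.exploreLength, hk⟩
  else ⟨(exploredAssignment h).greedy u, (greedy_isFeasible _).lt u⟩

theorem feasible_const (k : Fin P.K) : Feasible P fun _ => k := by
  have : Nonempty (Fin P.U) := ⟨⟨0, P.U_pos⟩⟩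
  rw [Feasible, image_const univ_nonempty, sum_singleton]
  exact P.cost_le k

theorem feasible_exploreThenCommit (h : List (Obs P)) : Feasible P (exploreThenCommit P h) := by
  unfold exploreThenCommit
  split_ifs
  · exact feasible_const _
  · exact isFeasible_exploredAssignment_iff.1 (greedy_isFeasible (exploredAssignment h))

end Learner

end CBR

namespace RealRAM

open CBR Finset BudgetedAssignment

section Round

variable {P : Params} {h : List (Obs P)} {m m' : Mem}

/-- The memory `m` at the beginning of the round after the observations `h`: the last observations
have not yet been added to the weights of the explored arm. -/
structure Pending (P : Params) (h : List (Obs P)) (m : Mem) : Prop where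
  params : m.nat 0 = (initMem P).nat 0
  cost : m.real 0 = (initMem P).real 0
  exploring : m.nat explored 0 < P.K →
    m.nat explored 0 * P.exploreLength + m.nat rounds 0 = h.length ∧
      m.nat rounds 0 ≤ P.exploreLength
  explored_all : P.K ≤ m.nat explored 0 → P.K * P.exploreLength ≤ h.length
  weight : ∀ (u : Fin P.U), ∀ k < P.K, m.real weights (k * P.U + u) +
    (if k = m.nat explored 0 then max 0 (m.real 1 u) else 0) = exploredSum h u k

/-- The memory `m` in the round after the observations `h`, when all of them have been processed. -/
structure Ready (P : Params) (h : List (Obs P)) (m : Mem) : Prop where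
  params : m.nat 0 = (initMem P).nat 0
  cost : m.real 0 = (initMem P).real 0
  rows : ∀ k ≤ P.K, m.nat row k = k * P.U
  exploring : m.nat explored 0 < P.K →
    m.nat explored 0 * P.exploreLength + m.nat rounds 0 = h.length + 1 ∧
      0 < m.nat rounds 0 ∧ m.nat rounds 0 ≤ P.exploreLength
  explored_all : P.K ≤ m.nat explored 0 → P.K * P.exploreLength ≤ h.length
  weight : ∀ (u : Fin P.U), ∀ k < P.K, m.real weights (k * P.U + u) = exploredSum h u k

theorem armDone_holds (hT : m.nat 0 0 = P.T) :
    armDone.holds m ↔ P.exploreLength ≤ m.nat rounds 0 := by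
  have cube : ((P.T : ℝ) ^ (2 / 3 : ℝ)) ^ 3 = (P.T : ℝ) * P.T := by
    rw [← Real.rpow_mul_natCast P.T.cast_nonneg]
    norm_num [sq]
  simp only [armDone, Test.holds, RExp.eval, NExp.eval, hT, Params.exploreLength, Nat.ceil_le]
  rw [← cube, ← pow_three', pow_le_pow_iff_left₀ (by positivity) (Nat.cast_nonneg _) three_ne_zero]

theorem Ready.users (hm : Ready P h m) : m.nat 0 1 = P.U := by simp [hm.params, initMem]

theorem Ready.encodes (hm : Ready P h m) : Encodes (exploredAssignment h) m where
  users := hm.users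
  arms := by simp [hm.params, initMem]
  budget := by simp [hm.params, initMem]
  cost k _ := by simp [hm.cost, initMem]
  weight k hk u := by rw [hm.rows k hk.le, hm.weight u k hk, exploredAssignment_weight]

theorem Ready.of_agreeOff {N R : Finset ℕ} (hm : Ready P h m) (ha : AgreeOff N R m m')
    (hN : Disjoint {0, row, explored, rounds} N) (hR : Disjoint {0, weights} R) :
    Ready P h m' := by
  simp only [disjoint_insert_left, disjoint_singleton_left] at hN hR
  obtain ⟨h₁, h₂, h₃, h₄, h₅, h₆⟩ := hm
  constructor <;>
    simpa only [ha.1 _ hN.1, ha.1 _ hN.2.1, ha.1 _ hN.2.2.1, ha.1 _ hN.2.2.2, ha.2 _ hR.1,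
      ha.2 _ hR.2]

theorem Ready.length_div (hm : Ready P h m) (hlt : m.nat explored 0 < P.K) :
    h.length / P.exploreLength = m.nat explored 0 := by
  obtain ⟨heq, hpos, hle⟩ := hm.exploring hlt
  refine Nat.div_eq_of_lt_le (by omega) ?_
  rw [add_mul]
  omega

theorem Ready.le_length_div (hm : Ready P h m) (hle : P.K ≤ m.nat explored 0) :
    P.K ≤ h.length / P.exploreLength :=
  (Nat.le_div_iff_mul_le P.exploreLength_pos).2 (hm.explored_all hle)

theorem Ready.pending (hm : Ready P h m) (x : Obs P) : Pending P (x :: h) (observe m x) where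
  params := hm.params
  cost := by simpa [observe] using hm.cost
  exploring hlt := (hm.exploring hlt).imp_right And.right
  explored_all hle := (hm.explored_all hle).trans (Nat.le_succ _)
  weight u k hk := by
    have arm_iff : k = m.nat explored 0 ↔ h.length / P.exploreLength = k := by
      rcases lt_or_ge (m.nat explored 0) P.K with hlt | hle
      · rw [hm.length_div hlt, eq_comm]
      · have := hm.le_length_div hle
        omega
    rw [exploredSum, ← hm.weight u k hk]
    simp [observe, arm_iff]

theorem pending_initMem (P : Params) : Pending P [] (initMem P) where
  params := rfl
  cost := rfl
  exploring _ := by simp [initMem]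
  explored_all hle := by simp_all [initMem]
  weight u k _ := by simp [initMem, exploredSum]

theorem mem_block_iff {U u k l : ℕ} (hu : u < U) :
    (l * U ≤ k * U + u ∧ k * U + u < l * U + U) ↔ k = l := by
  have hdiv : (k * U + u) / U = k := by
    rw [mul_comm, Nat.mul_add_div (by omega), Nat.div_eq_of_lt hu, add_zero]
  rw [← hdiv, Nat.div_eq_iff (by omega), hdiv]
  omega

theorem wp_advanceP (hT : m.nat 0 0 = P.T) :
    WP advanceP m fun n m' => n ≤ 40 ∧
      (P.exploreLength ≤ m.nat rounds 0 ∧ m'.nat explored 0 = m.nat explored 0 + 1 ∧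
          m'.nat rounds 0 = 1 ∨
        m.nat rounds 0 < P.exploreLength ∧ m'.nat explored 0 = m.nat explored 0 ∧
          m'.nat rounds 0 = m.nat rounds 0 + 1) := by
  have hold := armDone_holds hT
  refine wp_seq <| wp_cond
    (fun hb => wp_seq <| wp_setNat <| wp_setNat <| wp_setNat ⟨?_, .inl ⟨hold.1 hb, ?_⟩⟩)
    fun hb => wp_skip <| wp_setNat ⟨?_, .inr ⟨not_le.1 (mt hold.2 hb), ?_⟩⟩
  all_goals simp [armDone, Test.steps, RExp.steps, NExp.steps, NExp.eval]

theorem wp_record_advance (hm : Pending P h m) (hrow : ∀ k ≤ P.K, m.nat row k = k * P.U)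
    (hlt : m.nat explored 0 < P.K) :
    WP (.seq recordP advanceP) m fun n m' => n ≤ P.U * 49 + 60 ∧ Ready P h m' := by
  have users : m.nat 0 1 = P.U := by simp [hm.params, initMem]
  refine wp_seq <| (wp_recordP users).mono fun n₁ m₁ ⟨hn₁, hm₁⟩ => ?_
  have weight₁ (u : Fin P.U) (k : ℕ) (hk : k < P.K) :
      m₁.real weights (k * P.U + u) = exploredSum h u k := by
    rw [hm₁, setNat_real, fillReal_real_self, hrow _ hlt.le, ← hm.weight u k hk]
    simp only [mem_block_iff u.2]
    split_ifs with hk'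
    · simp [hk']
    · rw [add_zero]
  have params₁ : m₁.nat 0 = (initMem P).nat 0 := by simp [hm₁, hm.params]
  have cost₁ : m₁.real 0 = (initMem P).real 0 := by simp [hm₁, hm.cost]
  have row₁ : m₁.nat row = m.nat row := by simp [hm₁]
  have explored₁ : m₁.nat explored 0 = m.nat explored 0 := by simp [hm₁]
  have rounds₁ : m₁.nat rounds 0 = m.nat rounds 0 := by simp [hm₁]
  have time₁ : m₁.nat 0 0 = P.T := by simp [params₁, initMem]
  refine (wp_advanceP time₁).frame.mono fun n₂ m₂ ⟨⟨hn₂, hcount⟩, hm₂⟩ =>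
    ⟨by linarith [hn₁, hn₂], ?_⟩
  obtain ⟨hlen, hle⟩ := hm.exploring hlt
  rw [explored₁, rounds₁] at hcount
  have hpos := P.exploreLength_pos
  have hsucc : (m.nat explored 0 + 1) * P.exploreLength =
      m.nat explored 0 * P.exploreLength + P.exploreLength := Nat.succ_mul _ _
  refine ⟨?_, ?_, ?_, fun _ => ?_, fun hle₂ => ?_, ?_⟩
  · rw [hm₂.1 0 (by decide), params₁]
  · rw [hm₂.2 0 (by decide), cost₁]
  · rwa [hm₂.1 row (by decide), row₁]
  · rcases hcount with ⟨_, he₂, hr₂⟩ | ⟨_, he₂, hr₂⟩ <;> rw [he₂, hr₂] <;> omega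
  · rcases hcount with ⟨_, he₂, -⟩ | ⟨_, he₂, -⟩
    · rw [show P.K = m.nat explored 0 + 1 by omega]
      omega
    · omega
  · rwa [hm₂.2 weights (by decide)]

theorem wp_updateP (hm : Pending P h m) (hrow : ∀ k ≤ P.K, m.nat row k = k * P.U) :
    WP updateP m fun n m' => n ≤ P.U * 49 + 66 ∧ Ready P h m' := by
  have arms : m.nat 0 2 = P.K := by simp [hm.params, initMem]
  refine wp_cond (fun hb => wp_skip ⟨?_, ?_⟩) fun hb => ?_
  all_goals simp only [Test.holds, NExp.eval, arms, not_le] at hb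
  · simp [Test.steps, NExp.steps]
  · refine ⟨hm.params, hm.cost, hrow, fun hlt => absurd hb hlt.not_ge, hm.explored_all,
      fun u k hk => ?_⟩
    rw [← hm.weight u k hk, if_neg (hk.trans_le hb).ne, add_zero]
  · refine (wp_record_advance hm hrow hb).mono fun n m' ⟨hn, hm'⟩ => ⟨?_, hm'⟩
    simp only [Test.steps, NExp.steps]
    linarith [hn]

theorem wp_actP (hm : Ready P h m) :
    WP actP m fun n m' =>
      n ≤ P.K * (P.K * (P.U * 98 + 125) + P.U * 147 + 110) + P.U * 147 + 90 ∧
        ∀ u : Fin P.U, m'.nat output u = exploreThenCommit P h u := by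
  have arms : m.nat 0 2 = P.K := by simp [hm.params, initMem]
  refine wp_cond (fun hb => ?_) fun hb => ?_
  all_goals simp only [Test.holds, NExp.eval, arms, not_le] at hb
  · refine (wp_greedyP hm.encodes).mono fun n m' ⟨hn, hout⟩ => ⟨?_, fun u => ?_⟩
    · simp only [Test.steps, NExp.steps]
      simp only [exploredAssignment_K] at hn
      linarith [hn]
    · rw [hout, exploreThenCommit, dif_neg (hm.le_length_div hb).not_gt]
  · refine (wp_fillP hm.users).mono fun n m' ⟨hn, hm'⟩ => ⟨?_, fun u => ?_⟩
    · simp only [Test.steps, NExp.steps]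
      linarith [hn, Nat.zero_le (P.K * (P.K * (P.U * 98 + 125) + P.U * 147 + 110))]
    · simp only [hm', exploreThenCommit, hm.length_div hb, hb, dif_pos]
      simp

theorem round_steps_le {K U : ℕ} (hK : 0 < K) (hU : 0 < U) :
    (K * 49 + 15) + (U * 49 + 66) + (K * (K * (U * 98 + 125) + U * 147 + 110) + U * 147 + 90) + 2 ≤
      1000 * K ^ 3 * U := by
  have monomial_le {a b : ℕ} (ha : a ≤ 3) (hb : b ≤ 1) : K ^ a * U ^ b ≤ K ^ 3 * U := by
    simpa using Nat.mul_le_mul (Nat.pow_le_pow_right hK ha) (Nat.pow_le_pow_right hU hb)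
  have one := monomial_le (a := 0) (b := 0) (by simp) (by simp)
  have onlyK := monomial_le (a := 1) (b := 0) (by simp) (by simp)
  have onlyK2 := monomial_le (a := 2) (b := 0) (by simp) (by simp)
  have onlyU := monomial_le (a := 0) (b := 1) (by simp) (by simp)
  have mixed := monomial_le (a := 1) (b := 1) (by simp) (by simp)
  have mixed2 := monomial_le (a := 2) (b := 1) (by simp) (by simp)
  simp only [pow_zero, pow_one, one_mul, mul_one] at one onlyK onlyK2 onlyU mixed mixed2
  linarith

theorem wp_banditP (hm : Pending P h m) :
    WP banditP m fun n m' => n ≤ 1000 * P.K ^ 3 * P.U ∧ Ready P h m' ∧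
      ∀ u : Fin P.U, m'.nat output u = exploreThenCommit P h u := by
  have users : m.nat 0 1 = P.U := by simp [hm.params, initMem]
  have arms : m.nat 0 2 = P.K := by simp [hm.params, initMem]
  refine wp_seq <| (wp_rowsP users arms).mono fun n₁ m₁ ⟨hn₁, hm₁⟩ => ?_
  have hrow (k : ℕ) (hk : k ≤ P.K) : m₁.nat row k = k * P.U := by
    simp [hm₁, Nat.lt_succ_of_le hk]
  have hm₁ : Pending P h m₁ := by
    obtain ⟨h₁, h₂, h₃, h₄, h₅⟩ := hm
    constructor <;> simpa [hm₁]
  refine wp_seq <| (wp_updateP hm₁ hrow).mono fun n₂ m₂ ⟨hn₂, hm₂⟩ =>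
    (wp_actP hm₂).frame.mono fun n₃ m₃ ⟨⟨hn₃, hout⟩, hm₃⟩ =>
      ⟨?_, hm₂.of_agreeOff hm₃ (by decide) (by decide), hout⟩
  linarith [hn₁, hn₂, hn₃, round_steps_le P.K_pos P.U_pos]

theorem AtRound.pending (hm : AtRound banditP P h m) : Pending P h m := by
  induction hm with
  | start => exact pending_initMem P
  | next x _ he ih =>
    obtain ⟨n, m', he', -, hm', -⟩ := wp_banditP ih
    exact (he.unique he').2 ▸ hm'.pending x

theorem implements_banditP (P : Params) :
    Implements banditP (exploreThenCommit P) (1000 * P.K ^ 3 * P.U) := fun _ _ _ hm =>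
  let ⟨n, m', he, hn, _, hout⟩ := wp_banditP hm.pending
  ⟨n, m', he, hn, hout⟩

end Round

end RealRAM

namespace CBR
theorem length_history {P : Params} (A : Learner P) (r : Table P) (t : ℕ) :
    (A.history r t).length = t := by
  induction t with
  | zero => rfl
  | succ t ih => exact congrArg (· + 1) ih
end CBR

namespace CBR

theorem measurable_apply_of_countable {Ω ι β : Type*} [MeasurableSpace Ω] [Countable ι]
    [MeasurableSpace ι] [MeasurableSingletonClass ι] [MeasurableSpace β] {f : ι → Ω → β}
    {g : Ω → ι} (hf : ∀ i, Measurable (f i)) (hg : Measurable g) :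
    Measurable fun ω => f (g ω) ω :=
  (measurable_from_prod_countable_right (f := fun q : ι × Ω => f q.1 q.2) hf).comp
    (hg.prodMk measurable_id)

end CBR

namespace RealRAM

open CBR

/-- The memory after running a program with recursion depth at most `f`, a total function of the
initial memory; it is the final memory if `f` is at least the number of steps. -/
noncomputable def runFuel : ℕ → Prog → Mem → Mem
  | 0, _, m => m
  | _ + 1, .skip, m => m
  | _ + 1, .setNat a i e, m => m.setNat a (i.eval m) (e.eval m)
  | _ + 1, .setReal a i e, m => m.setReal a (i.eval m) (e.eval m)
  | f + 1, .seq c₁ c₂, m => runFuel f c₂ (runFuel f c₁ m)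
  | f + 1, .cond b c₁ c₂, m =>
    open Classical in if b.holds m then runFuel f c₁ m else runFuel f c₂ m
  | f + 1, .loop b c, m =>
    open Classical in if b.holds m then runFuel f (.loop b c) (runFuel f c m) else m

theorem Exec.runFuel_eq {c : Prog} {m m' : Mem} {n f : ℕ} (h : Exec c m n m') (hf : n ≤ f) :
    runFuel f c m = m' := by
  induction h generalizing f with
  | skip m => cases f <;> rfl
  | setNat a i e m => obtain _ | f := f; exacts [by omega, rfl]
  | setReal a i e m => obtain _ | f := f; exacts [by omega, rfl]
  | seq _ _ ih₁ ih₂ =>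
    obtain _ | f := f
    exacts [by omega, by rw [runFuel, ih₁ (by omega), ih₂ (by omega)]]
  | condTrue hb _ ih =>
    obtain _ | f := f
    exacts [by omega, by rw [runFuel, if_pos hb, ih (by omega)]]
  | condFalse hb _ ih =>
    obtain _ | f := f
    exacts [by omega, by rw [runFuel, if_neg hb, ih (by omega)]]
  | loopStop hb =>
    obtain _ | f := f
    exacts [by omega, by rw [runFuel, if_neg hb]]
  | loopStep hb _ _ ih₁ ih₂ =>
    obtain _ | f := f
    exacts [by omega, by rw [runFuel, if_pos hb, ih₁ (by omega), ih₂ (by omega)]]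

/-- A random memory all of whose cells are measurable. -/
structure MeasurableMem {Ω : Type*} [MeasurableSpace Ω] (φ : Ω → Mem) : Prop where
  nat : ∀ a i, Measurable fun ω => (φ ω).nat a i
  real : ∀ a i, Measurable fun ω => (φ ω).real a i

namespace MeasurableMem

variable {Ω : Type*} [MeasurableSpace Ω] {φ ψ : Ω → Mem}

theorem nexp_eval (hφ : MeasurableMem φ) (e : NExp) : Measurable fun ω => e.eval (φ ω) := by
  induction e with
  | lit n => exact measurable_const
  | get a e ih => exact measurable_apply_of_countable (hφ.nat a) ih
  | add e₁ e₂ ih₁ ih₂ => exact ih₁.add ih₂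
  | sub e₁ e₂ ih₁ ih₂ => exact ih₁.sub ih₂

theorem rexp_eval (hφ : MeasurableMem φ) (e : RExp) : Measurable fun ω => e.eval (φ ω) := by
  induction e with
  | ofNat e => exact measurable_from_top.comp (hφ.nexp_eval e)
  | get a e => exact measurable_apply_of_countable (hφ.real a) (hφ.nexp_eval e)
  | add e₁ e₂ ih₁ ih₂ => exact ih₁.add ih₂
  | sub e₁ e₂ ih₁ ih₂ => exact ih₁.sub ih₂
  | mul e₁ e₂ ih₁ ih₂ => exact ih₁.mul ih₂
  | div e₁ e₂ ih₁ ih₂ => exact ih₁.div ih₂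

theorem measurableSet_holds (hφ : MeasurableMem φ) (b : Test) :
    MeasurableSet {ω | b.holds (φ ω)} := by
  induction b with
  | natLe e₁ e₂ => exact measurableSet_le (hφ.nexp_eval e₁) (hφ.nexp_eval e₂)
  | realLe e₁ e₂ => exact measurableSet_le (hφ.rexp_eval e₁) (hφ.rexp_eval e₂)
  | neg b ih => exact ih.compl
  | conj b₁ b₂ ih₁ ih₂ => exact ih₁.inter ih₂

theorem ite (hφ : MeasurableMem φ) (hψ : MeasurableMem ψ) {p : Ω → Prop} [DecidablePred p]
    (hp : MeasurableSet {ω | p ω}) : MeasurableMem fun ω => if p ω then φ ω else ψ ω where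
  nat a i := by
    simp only [apply_ite (fun m : Mem => m.nat a i)]
    exact .ite hp (hφ.nat a i) (hψ.nat a i)
  real a i := by
    simp only [apply_ite (fun m : Mem => m.real a i)]
    exact .ite hp (hφ.real a i) (hψ.real a i)

theorem setNat (hφ : MeasurableMem φ) (a : ℕ) {i v : Ω → ℕ} (hi : Measurable i)
    (hv : Measurable v) : MeasurableMem fun ω => (φ ω).setNat a (i ω) (v ω) where
  nat b j := by
    rcases eq_or_ne b a with rfl | hb
    · simp only [Mem.setNat, Function.update_self, Function.update_apply]
      exact .ite (measurableSet_eq_fun measurable_const hi) hv (hφ.nat b j)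
    · simpa only [Mem.setNat, Function.update_of_ne hb] using hφ.nat b j
  real := hφ.real

theorem setReal (hφ : MeasurableMem φ) (a : ℕ) {i : Ω → ℕ} {v : Ω → ℝ} (hi : Measurable i)
    (hv : Measurable v) : MeasurableMem fun ω => (φ ω).setReal a (i ω) (v ω) where
  nat := hφ.nat
  real b j := by
    rcases eq_or_ne b a with rfl | hb
    · simp only [Mem.setReal, Function.update_self, Function.update_apply]
      exact .ite (measurableSet_eq_fun measurable_const hi) hv (hφ.real b j)
    · simpa only [Mem.setReal, Function.update_of_ne hb] using hφ.real b j

theorem runFuel (hφ : MeasurableMem φ) (f : ℕ) (c : Prog) :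
    MeasurableMem fun ω => runFuel f c (φ ω) := by
  induction f generalizing c φ with
  | zero => exact hφ
  | succ f ih =>
    cases c with
    | skip => exact hφ
    | setNat a i e => exact hφ.setNat a (hφ.nexp_eval i) (hφ.nexp_eval e)
    | setReal a i e => exact hφ.setReal a (hφ.nexp_eval i) (hφ.rexp_eval e)
    | seq c₁ c₂ => exact ih (ih hφ c₁) c₂
    | cond b c₁ c₂ => classical exact (ih hφ c₁).ite (ih hφ c₂) (hφ.measurableSet_holds b)
    | loop b c =>
      classical exact (ih (ih hφ c) (.loop b c)).ite hφ (hφ.measurableSet_holds b)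

theorem observe (hφ : MeasurableMem φ) {P : Params} {x : Ω → Obs P}
    (hx : ∀ u, Measurable fun ω => x ω u) : MeasurableMem fun ω => observe (φ ω) (x ω) where
  nat := hφ.nat
  real b j := by
    rcases eq_or_ne b 1 with rfl | hb
    · simp only [RealRAM.observe, Function.update_self]
      split_ifs
      exacts [hx _, hφ.real 1 j]
    · simpa only [RealRAM.observe, Function.update_of_ne hb] using hφ.real b j

end MeasurableMem

namespace Implements

variable {P : Params} {c : Prog} {A : Learner P} {τ t : ℕ}

theorem runFuel_spec (hc : Implements c A τ) {h : List (Obs P)} {m : Mem} (ht : h.length < P.T)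
    (hm : AtRound c P h m) (x : Obs P) :
    AtRound c P (x :: h) (observe (runFuel τ c m) x) ∧
      ∀ u : Fin P.U, (runFuel τ c m).nat 1 u = (A h u : ℕ) := by
  obtain ⟨n, m', hexec, hn, hout⟩ := hc h m ht hm
  rw [hexec.runFuel_eq hn]
  exact ⟨hm.next x hexec, hout⟩

theorem measurable_play_of_atRound (hc : Implements c A τ) (ht : t < P.T) {φ : Table P → Mem}
    (hφ : MeasurableMem φ) (hround : ∀ r, AtRound c P (A.history r t) (φ r)) (u : Fin P.U) :
    Measurable fun r => A.play r t u := by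
  have out_eq : ∀ r, (runFuel τ c (φ r)).nat 1 u = (A.play r t u : ℕ) := fun r =>
    (hc.runFuel_spec ((length_history A r t).trans_lt ht) (hround r) 0).2 u
  refine measurable_to_countable' fun k => ?_
  convert (hφ.runFuel τ c).nat 1 u (measurableSet_singleton (k : ℕ)) using 1
  ext r
  simp [out_eq, Fin.val_inj]

theorem exists_measurableMem (hc : Implements c A τ) (ht : t ≤ P.T) :
    ∃ φ : Table P → Mem, MeasurableMem φ ∧ ∀ r, AtRound c P (A.history r t) (φ r) := by
  induction t with
  | zero => exact ⟨fun _ => initMem P, ⟨fun _ _ => measurable_const, fun _ _ => measurable_const⟩,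
      fun _ => .start⟩
  | succ t ih =>
    obtain ⟨φ, hφ, hround⟩ := ih (Nat.le_of_succ_le ht)
    refine ⟨_, (hφ.runFuel τ c).observe fun u => ?_, fun r =>
      (hc.runFuel_spec ((length_history A r t).trans_lt ht) (hround r) _).1⟩
    exact measurable_apply_of_countable (f := fun k (r : Table P) => r (t, u, k))
      (fun k => measurable_pi_apply _) (hc.measurable_play_of_atRound ht hφ hround u)

theorem measurable_play (hc : Implements c A τ) (ht : t < P.T) (u : Fin P.U) :
    Measurable fun r => A.play r t u := by
  obtain ⟨φ, hφ, hround⟩ := hc.exists_measurableMem ht.le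
  exact hc.measurable_play_of_atRound ht hφ hround u

end Implements

end RealRAM

namespace CBR

open ProbabilityTheory

section Probability

variable {Ω : Type*} [MeasurableSpace Ω] {μ : Measure Ω}

theorem integral_abs_sub_integral_le_sqrt_variance [IsProbabilityMeasure μ] {X : Ω → ℝ}
    (hX : MemLp X 2 μ) : ∫ ω, |X ω - ∫ ω', X ω' ∂μ| ∂μ ≤ √(variance X μ) := by
  have deviation_memLp : MemLp (fun ω => |X ω - ∫ ω', X ω' ∂μ|) 2 μ :=
    (hX.sub (memLp_const _)).abs
  have variance_eq := variance_eq_sub deviation_memLp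
  simp only [Pi.pow_apply, sq_abs] at variance_eq
  rw [← variance_eq_integral hX.1.aemeasurable] at variance_eq
  exact Real.le_sqrt_of_sq_le (by linarith [variance_nonneg (fun ω => |X ω - ∫ ω', X ω' ∂μ|) μ])

theorem integral_apply_of_indepFun [IsFiniteMeasure μ] {ι : Type*} [Finite ι] [MeasurableSpace ι]
    [MeasurableSingletonClass ι] {X : ι → Ω → ℝ} {g : Ω → ι} (hX : ∀ i, Integrable (X i) μ)
    (hg : Measurable g) (hind : ∀ i, IndepFun g (X i) μ) :
    ∫ ω, X (g ω) ω ∂μ = ∫ ω, (∫ ω', X (g ω) ω' ∂μ) ∂μ := by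
  classical
  have := Fintype.ofFinite ι
  have indicator_measurable : ∀ i, Measurable fun j : ι => if j = i then (1 : ℝ) else 0 := fun i =>
    measurable_of_countable _
  have split : ∀ Y : ι → Ω → ℝ, (∀ i, Integrable (Y i) μ) →
      ∫ ω, Y (g ω) ω ∂μ = ∑ i, ∫ ω, (if g ω = i then 1 else 0) * Y i ω ∂μ := fun Y hY => by
    rw [← integral_finsetSum]
    · simp
    · exact fun i _ => (hY i).bdd_mul (c := 1)
        ((indicator_measurable i).comp hg).aestronglyMeasurable
        (.of_forall fun ω => by split_ifs <;> simp)
  rw [split X hX, split (fun i _ => ∫ ω', X i ω' ∂μ) fun i => integrable_const _]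
  refine Finset.sum_congr rfl fun i _ => ?_
  rw [integral_mul_const]
  exact ((hind i).comp (indicator_measurable i) measurable_id).integral_fun_mul_eq_mul_integral
    ((indicator_measurable i).comp hg).aestronglyMeasurable (hX i).1

end Probability

variable {P : Params}

section Env

namespace Env

variable (E : Env P)

instance (i : ℕ × Fin P.U × Fin P.K) : IsProbabilityMeasure (E.D i.2.1 i.2.2) := E.prob _ _

instance : IsProbabilityMeasure E.law := by
  unfold law
  infer_instance

theorem measurePreserving_eval (i : ℕ × Fin P.U × Fin P.K) :
    MeasurePreserving (fun r : Table P => r i) E.law (E.D i.2.1 i.2.2) :=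
  measurePreserving_eval_infinitePi (fun i : ℕ × Fin P.U × Fin P.K => E.D i.2.1 i.2.2) i

theorem iIndepFun_eval :
    iIndepFun (fun (i : ℕ × Fin P.U × Fin P.K) (r : Table P) => r i) E.law :=
  iIndepFun_infinitePi (P := fun i : ℕ × Fin P.U × Fin P.K => E.D i.2.1 i.2.2)
    (X := fun _ x => x) fun _ => measurable_id

theorem ae_mem_Icc : ∀ᵐ r ∂E.law, ∀ i, r i ∈ Set.Icc (0 : ℝ) 1 :=
  ae_all_iff.2 fun i =>
    (E.measurePreserving_eval i).quasiMeasurePreserving.ae (E.supp i.2.1 i.2.2)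

theorem memLp_eval (i : ℕ × Fin P.U × Fin P.K) : MemLp (fun r : Table P => r i) 2 E.law :=
  memLp_of_bounded (E.ae_mem_Icc.mono fun _ hr => hr i)
    (measurable_pi_apply i).aestronglyMeasurable 2

theorem integral_eval (i : ℕ × Fin P.U × Fin P.K) :
    ∫ r, r i ∂E.law = E.theta i.2.1 i.2.2 := by
  rw [theta, ← (E.measurePreserving_eval i).map_eq,
    integral_map (f := fun x => x) (E.measurePreserving_eval i).measurable.aemeasurable
      aestronglyMeasurable_id]

theorem theta_mem_Icc (u : Fin P.U) (k : Fin P.K) : E.theta u k ∈ Set.Icc (0 : ℝ) 1 := by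
  have := E.prob u k
  have nonneg : 0 ≤ᵐ[E.D u k] fun x => x := (E.supp u k).mono fun _ hx => hx.1
  refine ⟨integral_nonneg_of_ae nonneg, ?_⟩
  calc E.theta u k ≤ ∫ _, 1 ∂E.D u k :=
        integral_mono_of_nonneg nonneg (integrable_const 1) ((E.supp u k).mono fun _ hx => hx.2)
    _ = 1 := by simp

theorem value_mem_Icc (π : Matching P) : E.value π ∈ Set.Icc (0 : ℝ) P.U :=
  ⟨Finset.sum_nonneg fun u _ => (E.theta_mem_Icc u (π u)).1,
    (Finset.sum_le_sum fun u _ => (E.theta_mem_Icc u (π u)).2).trans (by simp)⟩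

theorem opt_mem_Icc : E.opt ∈ Set.Icc (0 : ℝ) P.U := by
  obtain ⟨π, -, hπ⟩ := E.isGreatest_opt.1
  exact hπ ▸ E.value_mem_Icc π

theorem variance_sum_eval_le (u : Fin P.U) (k : Fin P.K) (I : Finset ℕ) :
    variance (fun r : Table P => ∑ s ∈ I, r (s, u, k)) E.law ≤ I.card := by
  have sum_eq : (fun r : Table P => ∑ s ∈ I, r (s, u, k)) = ∑ s ∈ I, fun r => r (s, u, k) := by
    ext r
    rw [Finset.sum_apply]
  rw [sum_eq, IndepFun.variance_sum fun s _ => E.memLp_eval (s, u, k)]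
  · refine (Finset.sum_le_card_nsmul I _ 1 fun s _ => ?_).trans_eq (by simp)
    exact (variance_le_sq_of_bounded (E.ae_mem_Icc.mono fun r hr => hr (s, u, k))
      (measurable_pi_apply _).aemeasurable).trans (by norm_num)
  · exact fun s _ s' _ hne => E.iIndepFun_eval.indepFun fun h => hne (congrArg Prod.fst h)

end Env

end Env

section Learner

namespace Learner

variable (A : Learner P)

theorem history_congr {r r' : Table P} {t : ℕ}
    (h : ∀ s < t, ∀ u k, r (s, u, k) = r' (s, u, k)) : A.history r t = A.history r' t := by
  induction t with
  | zero => rfl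
  | succ t ih =>
    have history_eq := ih fun s hs => h s (hs.trans t.lt_succ_self)
    simp only [history, history_eq, h t t.lt_succ_self]

variable {A} {t : ℕ} {u : Fin P.U}

/-- The play of round `t` depends only on the entries of the table for earlier rounds. -/
theorem indepFun_play (hA : Measurable fun r => A.play r t u) (E : Env P) (k : Fin P.K) :
    IndepFun (fun r => A.play r t u) (fun r : Table P => r (t, u, k)) E.law := by
  classical
  let past : Finset (ℕ × Fin P.U × Fin P.K) := Finset.range t ×ˢ Finset.univ
  have disjoint : Disjoint past {(t, u, k)} := by simp [past]
  let extend : (past → ℝ) → Table P := fun v i => if h : i ∈ past then v ⟨i, h⟩ else 0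
  have extend_measurable : Measurable extend := measurable_pi_iff.2 fun i => by
    by_cases h : i ∈ past
    · simpa only [extend, h, dif_pos] using measurable_pi_apply _
    · simp only [extend, h, dif_neg, not_false_eq_true, measurable_const]
  have play_eq : ∀ r, A.play (extend fun i => r i) t u = A.play r t u := fun r => by
    unfold play
    rw [A.history_congr fun s hs u' k' => ?_]
    simp [extend, past, hs]
  have indep := (E.iIndepFun_eval.indepFun_finset past {(t, u, k)} disjoint
    measurable_pi_apply).comp (hA.comp extend_measurable)
      (measurable_pi_apply ⟨(t, u, k), Finset.mem_singleton_self _⟩)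
  exact indep.congr (.of_forall play_eq) (.of_forall fun _ => rfl)

theorem integrable_reward_at (hA : Measurable fun r => A.play r t u) (E : Env P) :
    Integrable (fun r : Table P => r (t, u, A.play r t u)) E.law :=
  .of_mem_Icc 0 1 (measurable_apply_of_countable (f := fun k (r : Table P) => r (t, u, k))
    (fun _ => measurable_pi_apply _) hA).aemeasurable (E.ae_mem_Icc.mono fun _ hr => hr _)

theorem integrable_theta_at (hA : Measurable fun r => A.play r t u) (E : Env P) :
    Integrable (fun r => E.theta u (A.play r t u)) E.law :=
  .of_mem_Icc 0 1 ((measurable_of_countable (E.theta u)).comp hA).aemeasurable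
    (.of_forall fun _ => E.theta_mem_Icc _ _)

theorem integral_reward_at (hA : Measurable fun r => A.play r t u) (E : Env P) :
    ∫ r, r (t, u, A.play r t u) ∂E.law = ∫ r, E.theta u (A.play r t u) ∂E.law := by
  rw [integral_apply_of_indepFun (X := fun k (r : Table P) => r (t, u, k))
    (fun k => (E.memLp_eval _).integrable one_le_two) hA (indepFun_play hA E)]
  simp only [E.integral_eval]

theorem integrable_value (hA : ∀ u, Measurable fun r => A.play r t u) (E : Env P) :
    Integrable (fun r => E.value (A.play r t)) E.law :=
  integrable_finsetSum _ fun u _ => integrable_theta_at (hA u) E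

theorem integrable_reward (hA : ∀ t < P.T, ∀ u, Measurable fun r => A.play r t u) (E : Env P) :
    Integrable A.reward E.law :=
  integrable_finsetSum _ fun t ht => integrable_finsetSum _ fun u _ =>
    integrable_reward_at (hA t (Finset.mem_range.1 ht) u) E

theorem integral_reward (hA : ∀ t < P.T, ∀ u, Measurable fun r => A.play r t u) (E : Env P) :
    ∫ r, A.reward r ∂E.law = ∑ t ∈ Finset.range P.T, ∫ r, E.value (A.play r t) ∂E.law := by
  unfold reward Env.value
  rw [integral_finsetSum _ fun t ht => integrable_finsetSum _ fun u _ =>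
    integrable_reward_at (hA t (Finset.mem_range.1 ht) u) E]
  refine Finset.sum_congr rfl fun t ht => ?_
  have hA := hA t (Finset.mem_range.1 ht)
  rw [integral_finsetSum _ fun u _ => integrable_reward_at (hA u) E,
    integral_finsetSum _ fun u _ => integrable_theta_at (hA u) E]
  exact Finset.sum_congr rfl fun u _ => integral_reward_at (hA u) E

end Learner

theorem alphaRegret_eq_sum {A : Learner P} (hA : ∀ t < P.T, ∀ u, Measurable fun r => A.play r t u)
    (α : ℝ) (E : Env P) :
    alphaRegret α E A =
      ∑ t ∈ Finset.range P.T, (α * E.opt - ∫ r, E.value (A.play r t) ∂E.law) := by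
  rw [alphaRegret, Learner.integral_reward hA, Finset.sum_sub_distrib, Finset.sum_const,
    Finset.card_range, nsmul_eq_mul]
  ring

theorem alphaRegret_nonpos_of_subsingleton [Subsingleton (Fin P.K)] {A : Learner P}
    (hA : ∀ t < P.T, ∀ u, Measurable fun r => A.play r t u) {α : ℝ} (hα : α ≤ 1) (E : Env P) :
    alphaRegret α E A ≤ 0 := by
  have value_eq : ∀ π, E.value π = E.opt := fun π => by
    obtain ⟨π', -, hπ'⟩ := E.isGreatest_opt.1
    rw [← hπ', Subsingleton.elim π π']
  rw [alphaRegret_eq_sum hA]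
  refine Finset.sum_nonpos fun t _ => ?_
  simp only [value_eq, integral_const, probReal_univ, one_smul, sub_nonpos]
  exact mul_le_of_le_one_left E.opt_mem_Icc.1 hα

end Learner

end CBR

namespace CBR

open Finset BudgetedAssignment

section Regret

variable {P : Params} {t : ℕ}

/-- Only a measurable learner has a meaningful expected reward; this learner is measurable because
it is implemented by a program. -/
theorem measurable_play_exploreThenCommit (ht : t < P.T) (u : Fin P.U) :
    Measurable fun r => (exploreThenCommit P).play r t u :=
  (RealRAM.implements_banditP P).measurable_play ht u

/-- The rounds in which the learner explores arm `k`. -/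
noncomputable def Params.exploreRounds (P : Params) (k : ℕ) : Finset ℕ :=
  Ico (k * P.exploreLength) ((k + 1) * P.exploreLength)

theorem card_exploreRounds (k : ℕ) : #(P.exploreRounds k) = P.exploreLength := by
  rw [Params.exploreRounds, Nat.card_Ico, add_mul, one_mul, Nat.add_sub_cancel_left]

theorem exploredSum_history (r : Table P) (t : ℕ) (u : Fin P.U) (k : Fin P.K) :
    exploredSum ((exploreThenCommit P).history r t) u k =
      ∑ s ∈ range t with s / P.exploreLength = k, max 0 (r (s, u, k)) := by
  rw [sum_filter]
  induction t with
  | zero => rfl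
  | succ t ih =>
    rw [Learner.history, exploredSum, ih, sum_range_succ, length_history]
    congr 1
    refine ite_congr rfl (fun hk => ?_) fun _ => rfl
    have play_eq : exploreThenCommit P ((exploreThenCommit P).history r t) u = k := by
      simp only [exploreThenCommit, length_history, hk, k.2, dif_pos, Fin.eta]
    rw [play_eq]

theorem exploredSum_history_eq_sum_exploreRounds (ht : P.K ≤ t / P.exploreLength) (r : Table P)
    (u : Fin P.U) (k : Fin P.K) :
    exploredSum ((exploreThenCommit P).history r t) u k =
      ∑ s ∈ P.exploreRounds k, max 0 (r (s, u, k)) := by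
  rw [exploredSum_history]
  congr 1
  ext s
  rw [mem_filter, mem_range, Params.exploreRounds, mem_Ico,
    Nat.div_eq_iff P.exploreLength_pos]
  have end_le : (k + 1) * P.exploreLength ≤ t :=
    (Nat.mul_le_mul_right _ k.2).trans ((Nat.le_div_iff_mul_le P.exploreLength_pos).1 ht)
  rw [add_mul, one_mul] at end_le ⊢
  have := P.exploreLength_pos
  omega

theorem sum_exploredSum_le_two_mul {h : List (Obs P)} (ht : P.K ≤ h.length / P.exploreLength)
    {π : Matching P} (hπ : Feasible P π) :
    ∑ u, exploredSum h u (π u) ≤ 2 * ∑ u, exploredSum h u (exploreThenCommit P h u) := by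
  have greedy_eq : ∀ u, (exploreThenCommit P h u : ℕ) = (exploredAssignment h).greedy u := fun u =>
    by rw [exploreThenCommit, dif_neg ht.not_gt]
  simp only [greedy_eq]
  exact value_le_two_mul_value_greedy (isFeasible_exploredAssignment_iff.2 hπ)

namespace Env

variable (E : Env P)

/-- The total deviation of the rewards in the exploration from their means. -/
noncomputable def explorationError (r : Table P) : ℝ :=
  ∑ u, ∑ k : Fin P.K,
    |∑ s ∈ P.exploreRounds k, max 0 (r (s, u, k)) - P.exploreLength * E.theta u k|

theorem abs_sum_exploreRounds_sub_ae_eq (u : Fin P.U) (k : Fin P.K) :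
    (fun r : Table P => |∑ s ∈ P.exploreRounds k, max 0 (r (s, u, k)) -
        P.exploreLength * E.theta u k|) =ᵐ[E.law]
      fun r => |∑ s ∈ P.exploreRounds k, r (s, u, k) -
        ∫ r', ∑ s ∈ P.exploreRounds k, r' (s, u, k) ∂E.law| := by
  filter_upwards [E.ae_mem_Icc] with r hr
  rw [integral_finsetSum _ fun s _ => (E.memLp_eval _).integrable one_le_two]
  simp only [max_eq_right (hr _).1, E.integral_eval, sum_const, card_exploreRounds, nsmul_eq_mul]

theorem memLp_sum_exploreRounds (u : Fin P.U) (k : Fin P.K) :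
    MemLp (fun r : Table P => ∑ s ∈ P.exploreRounds k, r (s, u, k)) 2 E.law :=
  memLp_finsetSum _ fun s _ => E.memLp_eval (s, u, k)

theorem integrable_abs_sum_exploreRounds_sub (u : Fin P.U) (k : Fin P.K) :
    Integrable (fun r : Table P => |∑ s ∈ P.exploreRounds k, max 0 (r (s, u, k)) -
      P.exploreLength * E.theta u k|) E.law :=
  (((E.memLp_sum_exploreRounds u k).integrable one_le_two).sub (integrable_const _)).abs.congr
    (E.abs_sum_exploreRounds_sub_ae_eq u k).symm

theorem integrable_explorationError : Integrable E.explorationError E.law :=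
  integrable_finsetSum _ fun u _ => integrable_finsetSum _ fun k _ =>
    E.integrable_abs_sum_exploreRounds_sub u k

theorem integral_explorationError_le :
    ∫ r, E.explorationError r ∂E.law ≤ P.U * P.K * √P.exploreLength := by
  have arm_le : ∀ u (k : Fin P.K), ∫ r : Table P, |∑ s ∈ P.exploreRounds k, max 0 (r (s, u, k)) -
      P.exploreLength * E.theta u k| ∂E.law ≤ √P.exploreLength := fun u k => by
    rw [integral_congr_ae (E.abs_sum_exploreRounds_sub_ae_eq u k)]
    refine (integral_abs_sub_integral_le_sqrt_variance (E.memLp_sum_exploreRounds u k)).trans ?_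
    exact Real.sqrt_le_sqrt ((E.variance_sum_eval_le u k _).trans_eq (by rw [card_exploreRounds]))
  unfold explorationError
  rw [integral_finsetSum _ fun u _ => integrable_finsetSum _ fun k _ =>
    E.integrable_abs_sum_exploreRounds_sub u k]
  simp only [integral_finsetSum _ fun k _ => E.integrable_abs_sum_exploreRounds_sub _ k]
  calc _ ≤ ∑ _u : Fin P.U, ∑ _k : Fin P.K, √P.exploreLength :=
        sum_le_sum fun u _ => sum_le_sum fun k _ => arm_le u k
    _ = P.U * P.K * √P.exploreLength := by simp [mul_assoc]

theorem abs_sum_sub_value_le_explorationError (r : Table P) (π : Matching P) :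
    |∑ u, ∑ s ∈ P.exploreRounds (π u), max 0 (r (s, u, π u)) - P.exploreLength * E.value π| ≤
      E.explorationError r := by
  rw [value, mul_sum, ← sum_sub_distrib]
  refine (abs_sum_le_sum_abs _ _).trans (sum_le_sum fun u _ => ?_)
  exact single_le_sum (f := fun k : Fin P.K => |∑ s ∈ P.exploreRounds k, max 0 (r (s, u, k)) -
    P.exploreLength * E.theta u k|) (fun _ _ => abs_nonneg _) (mem_univ (π u))

theorem half_opt_sub_value_play_le (ht : P.K ≤ t / P.exploreLength) (r : Table P) :
    1 / 2 * E.opt - E.value ((exploreThenCommit P).play r t) ≤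
      3 / 2 * (E.explorationError r / P.exploreLength) := by
  have length_pos : (0 : ℝ) < P.exploreLength := Nat.cast_pos.2 P.exploreLength_pos
  obtain ⟨π, hπ, value_eq⟩ := E.isGreatest_opt.1
  have half := sum_exploredSum_le_two_mul (h := (exploreThenCommit P).history r t)
    (by rwa [length_history]) hπ
  simp only [exploredSum_history_eq_sum_exploreRounds ht] at half
  have opt_close := (abs_le.1 (E.abs_sum_sub_value_le_explorationError r π)).1
  have play_close := (abs_le.1 (E.abs_sum_sub_value_le_explorationError r
    ((exploreThenCommit P).play r t))).2
  unfold Learner.play at play_close ⊢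
  rw [value_eq] at opt_close
  rw [← mul_div_assoc, le_div_iff₀ length_pos]
  linarith

theorem half_opt_sub_integral_value_play_le (ht : P.K ≤ t / P.exploreLength) (htT : t < P.T) :
    1 / 2 * E.opt - ∫ r, E.value ((exploreThenCommit P).play r t) ∂E.law ≤
      3 / 2 * (P.U * P.K / √P.exploreLength) := by
  have value_integrable : Integrable (fun r => E.value ((exploreThenCommit P).play r t)) E.law :=
    Learner.integrable_value (measurable_play_exploreThenCommit htT) E
  calc 1 / 2 * E.opt - ∫ r, E.value ((exploreThenCommit P).play r t) ∂E.law
      = ∫ r, (1 / 2 * E.opt - E.value ((exploreThenCommit P).play r t)) ∂E.law := by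
        rw [integral_sub (integrable_const _) value_integrable, integral_const, probReal_univ,
          one_smul]
    _ ≤ ∫ r, 3 / 2 * (E.explorationError r / P.exploreLength) ∂E.law :=
        integral_mono ((integrable_const _).sub value_integrable)
          ((E.integrable_explorationError.div_const _).const_mul _)
          (E.half_opt_sub_value_play_le ht)
    _ = 3 / 2 * ((∫ r, E.explorationError r ∂E.law) / P.exploreLength) := by
        rw [integral_const_mul, integral_div]
    _ ≤ 3 / 2 * (P.U * P.K * √P.exploreLength / P.exploreLength) := by
        gcongr
        exact E.integral_explorationError_le
    _ = 3 / 2 * (P.U * P.K / √P.exploreLength) := by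
        rw [mul_div_assoc, Real.sqrt_div_self', mul_one_div]

end Env

theorem half_opt_sub_integral_value_play_le_half (E : Env P) (A : Learner P) (t : ℕ) :
    1 / 2 * E.opt - ∫ r, E.value (A.play r t) ∂E.law ≤ P.U / 2 := by
  have value_nonneg : 0 ≤ ∫ r, E.value (A.play r t) ∂E.law :=
    integral_nonneg fun r => (E.value_mem_Icc _).1
  linarith [E.opt_mem_Icc.2]

theorem alphaRegret_exploreThenCommit_le_add (E : Env P) :
    alphaRegret (1 / 2) E (exploreThenCommit P) ≤ P.K * P.exploreLength * (P.U / 2) +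
      P.T * (3 / 2 * (P.U * P.K / √P.exploreLength)) := by
  rw [alphaRegret_eq_sum fun _ => measurable_play_exploreThenCommit]
  have round_le : ∀ t ∈ range P.T,
      1 / 2 * E.opt - ∫ r, E.value ((exploreThenCommit P).play r t) ∂E.law ≤
        (if t ∈ range (P.K * P.exploreLength) then (P.U / 2 : ℝ) else 0) +
          3 / 2 * (P.U * P.K / √P.exploreLength) := fun t ht => by
    have error_nonneg : (0 : ℝ) ≤ 3 / 2 * (P.U * P.K / √P.exploreLength) := by positivity
    split_ifs with hexplore
    · exact (half_opt_sub_integral_value_play_le_half E _ t).trans (le_add_of_nonneg_right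
        error_nonneg)
    · rw [zero_add]
      refine E.half_opt_sub_integral_value_play_le ?_ (mem_range.1 ht)
      rwa [mem_range, not_lt, ← Nat.le_div_iff_mul_le P.exploreLength_pos] at hexplore
  refine (sum_le_sum round_le).trans ?_
  rw [sum_add_distrib, sum_const, card_range, nsmul_eq_mul, ← sum_filter, sum_const, nsmul_eq_mul]
  have card_le : #{t ∈ range P.T | t ∈ range (P.K * P.exploreLength)} ≤
      P.K * P.exploreLength :=
    (card_le_card fun t ht => (mem_filter.1 ht).2).trans (card_range _).le
  gcongr
  exact_mod_cast card_le

theorem Params.exploreLength_le (P : Params) :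
    (P.exploreLength : ℝ) ≤ 2 * (P.T : ℝ) ^ (2 / 3 : ℝ) := by
  have one_le : 1 ≤ (P.T : ℝ) ^ (2 / 3 : ℝ) :=
    Real.one_le_rpow (Nat.one_le_cast.2 P.T_pos) (by norm_num)
  have ceil_lt := Nat.ceil_lt_add_one (zero_le_one.trans one_le)
  rw [Params.exploreLength]
  linarith

theorem Params.T_div_sqrt_exploreLength_le (P : Params) :
    P.T / √P.exploreLength ≤ (P.T : ℝ) ^ (2 / 3 : ℝ) := by
  have T_pos : (0 : ℝ) < P.T := Nat.cast_pos.2 P.T_pos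
  rw [div_le_iff₀ (Real.sqrt_pos.2 (Nat.cast_pos.2 P.exploreLength_pos))]
  calc (P.T : ℝ) = (P.T : ℝ) ^ (2 / 3 : ℝ) * √((P.T : ℝ) ^ (2 / 3 : ℝ)) := by
        rw [Real.sqrt_eq_rpow, ← Real.rpow_mul T_pos.le, ← Real.rpow_add T_pos]
        norm_num
    _ ≤ (P.T : ℝ) ^ (2 / 3 : ℝ) * √P.exploreLength := by
        gcongr
        exact Nat.le_ceil _

theorem alphaRegret_exploreThenCommit_le (E : Env P) :
    alphaRegret (1 / 2) E (exploreThenCommit P) ≤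
      5 / 2 * (P.U * P.K * (P.T : ℝ) ^ (2 / 3 : ℝ)) := by
  calc alphaRegret (1 / 2) E (exploreThenCommit P)
      ≤ P.K * P.exploreLength * (P.U / 2) + P.T * (3 / 2 * (P.U * P.K / √P.exploreLength)) :=
        alphaRegret_exploreThenCommit_le_add E
    _ = P.K * P.exploreLength * (P.U / 2) + 3 / 2 * (P.U * P.K) * (P.T / √P.exploreLength) := by
        ring
    _ ≤ P.K * (2 * (P.T : ℝ) ^ (2 / 3 : ℝ)) * (P.U / 2) +
          3 / 2 * (P.U * P.K) * (P.T : ℝ) ^ (2 / 3 : ℝ) := by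
        gcongr
        exacts [P.exploreLength_le, P.T_div_sqrt_exploreLength_le]
    _ = 5 / 2 * (P.U * P.K * (P.T : ℝ) ^ (2 / 3 : ℝ)) := by ring

theorem beta_nonneg (P : Params) : 0 ≤ beta P :=
  div_nonneg (Nat.cast_nonneg _) (Real.iInf_nonneg fun k => (P.cost_pos k).le)

theorem K_le_K_add_beta_rpow (P : Params) : (P.K : ℝ) ≤ (P.K + beta P) ^ (4 / 3 : ℝ) := by
  have one_le_K : (1 : ℝ) ≤ P.K := Nat.one_le_cast.2 P.K_pos
  have beta_nonneg := beta_nonneg P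
  exact (le_add_of_nonneg_right beta_nonneg).trans
    (Real.self_le_rpow_of_one_le (by linarith) (by norm_num))

theorem half_le_log_rpow {x : ℝ} (hx : 2 ≤ x) : 1 / 2 ≤ Real.log x ^ (1 / 3 : ℝ) := by
  have half_le_log : 1 / 2 ≤ Real.log x := by
    linarith [Real.log_two_gt_d9, Real.log_le_log two_pos hx]
  calc (1 / 2 : ℝ) ≤ (1 / 2) ^ (1 / 3 : ℝ) :=
        Real.self_le_rpow_of_le_one (by norm_num) (by norm_num) (by norm_num)
    _ ≤ Real.log x ^ (1 / 3 : ℝ) := by gcongr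

/-- The factor `(log T) ^ (1 / 3)` vanishes for `T = 1`; then there is a single arm, hence no
regret. -/
theorem alphaRegret_exploreThenCommit_le_log (E : Env P) :
    alphaRegret (1 / 2) E (exploreThenCommit P) ≤
      5 * (P.U * ((P.K : ℝ) + beta P) ^ (4 / 3 : ℝ) * (P.T : ℝ) ^ (2 / 3 : ℝ) *
        Real.log P.T ^ (1 / 3 : ℝ)) := by
  have base_nonneg : 0 ≤ (P.K : ℝ) + beta P := add_nonneg P.K.cast_nonneg (beta_nonneg P)
  obtain hT | hT := (Nat.succ_le_of_lt P.T_pos).eq_or_lt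
  · have : Subsingleton (Fin P.K) := Fin.subsingleton_iff_le_one.2 (P.K_le_T.trans hT.ge)
    refine (alphaRegret_nonpos_of_subsingleton (fun _ => measurable_play_exploreThenCommit)
      (by norm_num) E).trans ?_
    have := Real.log_natCast_nonneg P.T
    positivity
  · have log_le := half_le_log_rpow (Nat.ofNat_le_cast.2 hT : (2 : ℝ) ≤ P.T)
    calc alphaRegret (1 / 2) E (exploreThenCommit P)
        ≤ 5 / 2 * (P.U * P.K * (P.T : ℝ) ^ (2 / 3 : ℝ)) := alphaRegret_exploreThenCommit_le E
      _ = 5 * (P.U * P.K * (P.T : ℝ) ^ (2 / 3 : ℝ) * (1 / 2)) := by ring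
      _ ≤ _ := by
        gcongr
        exact K_le_K_add_beta_rpow P

end Regret

end CBR

theorem mainTheorem12 :
    ∃ (c : RealRAM.Prog) (C₁ : ℕ) (C₂ : ℝ), ∀ P : CBR.Params, ∃ A : CBR.Learner P,
      RealRAM.Implements c A (C₁ * P.K ^ 3 * P.U) ∧
      (∀ h : List (CBR.Obs P), h.length < P.T → CBR.Feasible P (A h)) ∧
      ∀ E : CBR.Env P,
        Integrable (CBR.Learner.reward A) E.law ∧
        CBR.alphaRegret (1 / 2) E A ≤
          C₂ * (P.U * ((P.K : ℝ) + CBR.beta P) ^ (4 / 3 : ℝ) * (P.T : ℝ) ^ (2 / 3 : ℝ) *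
            Real.log P.T ^ (1 / 3 : ℝ)) :=
  ⟨RealRAM.banditP, 1000, 5, fun P => ⟨CBR.exploreThenCommit P, RealRAM.implements_banditP P,
    fun h _ => CBR.feasible_exploreThenCommit h, fun E =>
      ⟨CBR.Learner.integrable_reward (fun _ => CBR.measurable_play_exploreThenCommit) E,
        CBR.alphaRegret_exploreThenCommit_le_log E⟩⟩⟩
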